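/- Let $d\ge 1$ be an integer, let $B_d$ be the open unit ball of $\mathbb{C}^d$ and $\nu$ the Lebesgue volume measure on $B_d$ normalized by $\nu(B_d)=1$. A function $w:[0,1)\to(0,+\infty)$ is called a weight if it is continuous and non-decreasing; a weight $w$ is log-convex if $\log w(r)$ is a convex function of $\log r$, $0<r<1$. For a holomorphic function $f$ on $B_d$, $0<q<\infty$ and a continuous $u:[0,1)\to(0,+\infty)$ put \[ M_{q,u}(f,r)=\left(\frac{1}{r^{2d}}\int_{rB_d}|f(z)|^q\,u(|z|)\,d\nu(z)\right)^{1/q},\quad 0<r<1,\qquad M_{q,u}(f,0)=|f(0)|\,u(0)^{1/q}. \] Proposition 3.1. Let $0<q<\infty$ and let $\varphi,w:[0,1)\to(0,+\infty)$ be log-convex weights. Then there exists a holomorphic function $f$ on $B_d$ such that \[ M_{q,\frac1\varphi}(f,r)\asymp w(r),\quad 0\le r<1, \] that is, $M_{q,\frac1\varphi}(f,r)>0$ for all $r\in[0,1)$ and there are constants $C_1,C_2>0$ with $C_1M_{q,\frac1\varphi}(f,r)\le w(r)\le C_2M_{q,\frac1\varphi}(f,r)$ for all $r\in[0,1)$.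 -/

import Mathlib

open MeasureTheory

/-- A weight on `[0, 1)`: a continuous non-decreasing function `[0, 1) → (0, +∞)`.
It is represented by a function on `ℝ` of which only the values on `[0, 1)` matter. -/
structure IsWeight (w : ℝ → ℝ) : Prop where
  pos : ∀ r ∈ Set.Ico (0 : ℝ) 1, 0 < w r
  continuousOn : ContinuousOn w (Set.Ico 0 1)
  monotoneOn : MonotoneOn w (Set.Ico 0 1)

/-- A log-convex weight: a weight such that `log w(r)` is a convex function of
`x = log r`, where `0 < r < 1`, that is, `x < 0`. -/
structure IsLogConvexWeight (w : ℝ → ℝ) : Prop extends IsWeight w where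
  logConvex : ConvexOn ℝ (Set.Iio (0 : ℝ)) (fun x => Real.log (w (Real.exp x)))

/-- `u ≍ v` on `X`: there are constants `C₁, C₂ > 0` with `C₁ u ≤ v ≤ C₂ u` on `X`.
Both functions are required to be strictly positive on `X`. -/
def EquivalentOn (X : Set ℝ) (u v : ℝ → ℝ) : Prop :=
  (∀ x ∈ X, 0 < u x ∧ 0 < v x) ∧
    ∃ C₁ C₂ : ℝ, 0 < C₁ ∧ 0 < C₂ ∧ ∀ x ∈ X, C₁ * u x ≤ v x ∧ v x ≤ C₂ * u x

/-- The open unit ball `B_d` of `ℂ^d` for the Euclidean norm. -/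
def unitBall (d : ℕ) : Set (EuclideanSpace ℂ (Fin d)) := Metric.ball 0 1

/-- The normalized volume measure `ν` on the unit ball: `ν(B_d) = 1`. -/
noncomputable def normalizedVolume (d : ℕ) : Measure (EuclideanSpace ℂ (Fin d)) :=
  (volume (unitBall d))⁻¹ • volume.restrict (unitBall d)

/-- The weighted volume integral mean `M_{q,u}(f, r)`:
`(r^{-2d} ∫_{r B_d} |f(z)|^q u(|z|) dν(z))^{1/q}` for `0 < r < 1`,
and `|f(0)| u(0)^{1/q}` for `r = 0`. -/
noncomputable def volumeMean (d : ℕ) (q : ℝ) (u : ℝ → ℝ)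
    (f : EuclideanSpace ℂ (Fin d) → ℂ) (r : ℝ) : ℝ :=
  if r = 0 then ‖f 0‖ * u 0 ^ (1 / q)
  else (1 / r ^ (2 * d) *
    ∫ z in Metric.ball (0 : EuclideanSpace ℂ (Fin d)) r,
      ‖f z‖ ^ q * u ‖z‖ ∂(normalizedVolume d)) ^ (1 / q)

/-! Put `W = w ^ q`. If `w` is bounded, `f = 1` works: its mean is a power of a moment of `1 / φ`
that stays between positive constants.

If `w` is unbounded, `f` is a lacunary series `∑ α j * z₁ ^ n j`. By polar coordinates the mean of
`|z₁| ^ (n q)` is a constant times `F n r = r ^ (n q) * J r`, where `J` is the moment of order `n q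
+ 2 d - 1` of `1 / φ (r s)`. Since `W` is unbounded and `F n` is bounded, `F n / W` has a maximum,
at some `y n`; scaled to have maximum `1` it is called `τ n`. Three monotonicity facts govern these
functions: (1) `F (n + 1) / F n` is non-decreasing (`radialMoment_mul_le`); (2) `F (n + 1) / (r ^ q
F n)` is non-increasing, by log-convexity of `φ` (`dilatedMoment_mul_le`); (3) `log (F n / W)` is
concave in `log r`, by log-convexity of `φ` and `w` (`concaveOn_log_radialMoment`). By (2),
neighbouring `τ n` are comparable at each other's peaks. Hence a greedy choice of indices
(`exists_sparse`) can make consecutive chosen functions small at each other's peak without opening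
gaps: by (3), one of the two chosen functions whose peaks surround `r` is bounded below at `r`. By
(1), the other chosen functions decay geometrically away from these two.

It remains to pass from single terms to the sum. The power `min 1 (1 / q)` of `∫ |f| ^ q / φ` is
subadditive for every `q > 0`, so all but two terms form a small error. The two remaining monomials
`A`, `B` have different degrees and cannot cancel: a rotation of the variable turns `A + B` into a
unimodular multiple of `A - B`, so both have the same size, and `2 A = (A + B) + (A - B)`
(`lpGauge_dominated_sum`). -/

/-- Log-convexity of a weight as an inequality between the values at four points. -/
theorem IsLogConvexWeight.mul_le_mul {φ : ℝ → ℝ} (hφ : IsLogConvexWeight φ) {a b s t : ℝ}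
    (ha : 0 ≤ a) (hab : a ≤ b) (hs : 0 ≤ s) (hst : s ≤ t) (hbt : b * t < 1) :
    φ (a * t) * φ (b * s) ≤ φ (a * s) * φ (b * t) := by
  have hb : 0 ≤ b := ha.trans hab
  have ht : 0 ≤ t := hs.trans hst
  have h1 : a * s ≤ a * t := by gcongr
  have h2 : a * s ≤ b * s := by gcongr
  have h3 : a * t ≤ b * t := by gcongr
  have h4 : b * s ≤ b * t := by gcongr
  have h0 : 0 ≤ a * s := by positivity
  have m1 : a * s ∈ Set.Ico (0 : ℝ) 1 := ⟨h0, by linarith⟩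
  have m2 : a * t ∈ Set.Ico (0 : ℝ) 1 := ⟨by linarith, by linarith⟩
  have m3 : b * s ∈ Set.Ico (0 : ℝ) 1 := ⟨by linarith, by linarith⟩
  have m4 : b * t ∈ Set.Ico (0 : ℝ) 1 := ⟨by linarith, by linarith⟩
  -- Log-convexity says nothing at the origin; if `a` or `s` vanishes, monotonicity alone suffices.
  rcases ha.eq_or_lt with rfl | ha
  · simp only [zero_mul] at *
    exact mul_le_mul_of_nonneg_left (hφ.monotoneOn m3 m4 h4) (hφ.pos _ m1).le
  rcases hs.eq_or_lt with rfl | hs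
  · simp only [mul_zero] at *
    rw [mul_comm]
    exact mul_le_mul_of_nonneg_left (hφ.monotoneOn m2 m4 h3) (hφ.pos _ m1).le
  have hb : 0 < b := ha.trans_le hab
  have ht : 0 < t := hs.trans_le hst
  have key : ∀ x, 0 < x → x < 1 → Real.log x ∈ Set.Iio (0 : ℝ) := fun x h h' => Real.log_neg h h'
  rcases eq_or_lt_of_le (h1.trans h3) with heq | hlt
  · have e1 : a * t = a * s := by linarith
    have e2 : b * s = a * s := by linarith
    rw [e1, e2, ← heq]
  have hA : 0 < a * s := by positivity
  have hB : 0 < a * t := by positivity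
  have hC : 0 < b * s := by positivity
  have hD : 0 < b * t := by positivity
  have hlog : Real.log (a * s) + Real.log (b * t) = Real.log (a * t) + Real.log (b * s) := by
    rw [← Real.log_mul hA.ne' hD.ne', ← Real.log_mul hB.ne' hC.ne']
    congr 1; ring
  have l1 : Real.log (a * s) ≤ Real.log (a * t) := Real.log_le_log hA h1
  have l3 : Real.log (a * t) ≤ Real.log (b * t) := Real.log_le_log hB h3
  have llt : Real.log (a * s) < Real.log (b * t) := Real.log_lt_log hA hlt
  set A := Real.log (a * s)
  set D := Real.log (b * t)
  set B := Real.log (a * t)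
  set C := Real.log (b * s)
  have hDA : 0 < D - A := by linarith
  -- As `A + D = B + C`, the points `B` and `C` are mirror-image convex combinations of `A` and `D`:
  -- the weights of `B`, exchanged, give `C`. Adding the two convexity inequalities yields the
  -- claim.
  obtain ⟨u, hu⟩ : ∃ u, u = (D - B) / (D - A) := ⟨_, rfl⟩
  obtain ⟨v, hv⟩ : ∃ v, v = (B - A) / (D - A) := ⟨_, rfl⟩
  have hu0 : 0 ≤ u := hu ▸ div_nonneg (by linarith) hDA.le
  have hv0 : 0 ≤ v := hv ▸ div_nonneg (by linarith) hDA.le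
  have huv : u + v = 1 := by rw [hu, hv]; field_simp; ring
  have eB : u * A + v * D = B := by rw [hu, hv]; field_simp; ring
  have eC : v * A + u * D = C := by
    have : v * A + u * D = (u + v) * (A + D) - (u * A + v * D) := by ring
    rw [this, huv, eB]; linarith
  have c1 := hφ.logConvex.2 (key _ hA m1.2) (key _ hD m4.2) hu0 hv0 huv
  have c2 := hφ.logConvex.2 (key _ hA m1.2) (key _ hD m4.2) hv0 hu0 (by linarith)
  simp only [smul_eq_mul] at c1 c2
  change Real.log (φ (Real.exp (u * A + v * D))) ≤ _ at c1
  change Real.log (φ (Real.exp (v * A + u * D))) ≤ _ at c2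
  rw [eB] at c1
  rw [eC] at c2
  rw [Real.exp_log hA, Real.exp_log hD] at c1 c2
  rw [Real.exp_log hB] at c1
  rw [Real.exp_log hC] at c2
  rw [← Real.log_le_log_iff (mul_pos (hφ.pos _ m2) (hφ.pos _ m3))
    (mul_pos (hφ.pos _ m1) (hφ.pos _ m4)),
    Real.log_mul (hφ.pos _ m2).ne' (hφ.pos _ m3).ne',
    Real.log_mul (hφ.pos _ m1).ne' (hφ.pos _ m4).ne']
  have : ∀ P Q : ℝ, u * P + v * Q + (v * P + u * Q) = P + Q := by
    intro P Q
    have : u * P + v * Q + (v * P + u * Q) = (u + v) * (P + Q) := by ring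
    rw [this, huv, one_mul]
  linarith [this (Real.log (φ (a * s))) (Real.log (φ (b * t)))]

/-! ### Moments of the reciprocal weight -/

/-- The moment `∫₀¹ s ^ p / φ (r s) ds`. -/
noncomputable def dilatedMoment (φ : ℝ → ℝ) (p r : ℝ) : ℝ :=
  ∫ s in (0 : ℝ)..1, s ^ p / φ (r * s)

/-- The moment `∫₀ʳ t ^ p / φ t dt`. -/
noncomputable def radialMoment (φ : ℝ → ℝ) (p r : ℝ) : ℝ :=
  ∫ t in (0 : ℝ)..r, t ^ p / φ t

section Moments

variable {φ : ℝ → ℝ} {p r : ℝ}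

theorem IsWeight.mul_mem_Ico {r s : ℝ} (hr : r ∈ Set.Ico (0 : ℝ) 1)
    (hs : s ∈ Set.Icc (0 : ℝ) 1) : r * s ∈ Set.Ico (0 : ℝ) 1 :=
  ⟨mul_nonneg hr.1 hs.1, by nlinarith [hr.1, hr.2, hs.1, hs.2]⟩

theorem IsWeight.continuousOn_rpow_div (hφ : IsWeight φ) (hp : 0 ≤ p) :
    ContinuousOn (fun t => t ^ p / φ t) (Set.Ico 0 1) :=
  (Real.continuous_rpow_const hp).continuousOn.div hφ.continuousOn
    fun x hx => (hφ.pos x hx).ne'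

theorem IsWeight.continuousOn_dilated (hφ : IsWeight φ) (hr : r ∈ Set.Ico (0 : ℝ) 1) :
    ContinuousOn (fun s => φ (r * s)) (Set.Icc 0 1) :=
  hφ.continuousOn.comp (by fun_prop) fun _ hs => IsWeight.mul_mem_Ico hr hs

theorem IsWeight.continuousOn_rpow_div_dilated (hφ : IsWeight φ) (hp : 0 ≤ p)
    (hr : r ∈ Set.Ico (0 : ℝ) 1) :
    ContinuousOn (fun s => s ^ p / φ (r * s)) (Set.Icc 0 1) :=
  (Real.continuous_rpow_const hp).continuousOn.div (hφ.continuousOn_dilated hr)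
    fun _ hs => (hφ.pos _ (IsWeight.mul_mem_Ico hr hs)).ne'

theorem IsWeight.intervalIntegrable_dilated (hφ : IsWeight φ) (hp : 0 ≤ p)
    (hr : r ∈ Set.Ico (0 : ℝ) 1) :
    IntervalIntegrable (fun s => s ^ p / φ (r * s)) volume 0 1 := by
  apply ContinuousOn.intervalIntegrable
  rw [Set.uIcc_of_le zero_le_one]
  exact hφ.continuousOn_rpow_div_dilated hp hr

theorem IsWeight.intervalIntegrable_radial (hφ : IsWeight φ) (hp : 0 ≤ p) {a b : ℝ}
    (ha : 0 ≤ a) (hab : a ≤ b) (hb : b < 1) :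
    IntervalIntegrable (fun t => t ^ p / φ t) volume a b := by
  apply ContinuousOn.intervalIntegrable
  rw [Set.uIcc_of_le hab]
  exact (hφ.continuousOn_rpow_div hp).mono fun x hx => ⟨ha.trans hx.1, hx.2.trans_lt hb⟩

theorem IsWeight.dilatedMoment_anti (hφ : IsWeight φ) (hp : 0 ≤ p) :
    AntitoneOn (dilatedMoment φ p) (Set.Ico 0 1) := by
  intro a ha b hb hab
  refine intervalIntegral.integral_mono_on zero_le_one (hφ.intervalIntegrable_dilated hp hb)
    (hφ.intervalIntegrable_dilated hp ha) fun s hs => ?_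
  have ha' := IsWeight.mul_mem_Ico ha hs
  exact div_le_div_of_nonneg_left (Real.rpow_nonneg hs.1 _) (hφ.pos _ ha')
    (hφ.monotoneOn ha' (IsWeight.mul_mem_Ico hb hs) (mul_le_mul_of_nonneg_right hab hs.1))

theorem dilatedMoment_zero (φ : ℝ → ℝ) (hp : 0 ≤ p) :
    dilatedMoment φ p 0 = 1 / ((p + 1) * φ 0) := by
  have : p + 1 ≠ 0 := by positivity
  simp only [dilatedMoment, zero_mul, intervalIntegral.integral_div]
  rw [integral_rpow (Or.inl (by linarith))]
  simp [Real.zero_rpow this]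
  ring

theorem IsWeight.dilatedMoment_le (hφ : IsWeight φ) (hp : 0 ≤ p) (hr : r ∈ Set.Ico (0 : ℝ) 1) :
    dilatedMoment φ p r ≤ 1 / ((p + 1) * φ 0) := by
  rw [← dilatedMoment_zero φ hp]
  exact hφ.dilatedMoment_anti hp ⟨le_rfl, zero_lt_one⟩ hr hr.1

theorem IsWeight.le_dilatedMoment (hφ : IsWeight φ) (hp : 0 ≤ p) (hr : r ∈ Set.Ico (0 : ℝ) 1) :
    1 / ((p + 1) * φ r) ≤ dilatedMoment φ p r := by
  have hp1 : p + 1 ≠ 0 := by positivity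
  have : 1 / ((p + 1) * φ r) = ∫ s in (0 : ℝ)..1, s ^ p / φ r := by
    simp only [intervalIntegral.integral_div]
    rw [integral_rpow (Or.inl (by linarith))]
    simp [Real.zero_rpow hp1]
    ring
  rw [this]
  refine intervalIntegral.integral_mono_on zero_le_one ?_
    (hφ.intervalIntegrable_dilated hp hr) fun s hs => ?_
  · exact ((Real.continuous_rpow_const hp).div_const _).intervalIntegrable _ _
  · have hrs := IsWeight.mul_mem_Ico hr hs
    exact div_le_div_of_nonneg_left (Real.rpow_nonneg hs.1 _) (hφ.pos _ hrs)
      (hφ.monotoneOn hrs hr (mul_le_of_le_one_right hr.1 hs.2))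

theorem IsWeight.dilatedMoment_pos (hφ : IsWeight φ) (hp : 0 ≤ p) (hr : r ∈ Set.Ico (0 : ℝ) 1) :
    0 < dilatedMoment φ p r :=
  lt_of_lt_of_le (one_div_pos.2 (mul_pos (by positivity) (hφ.pos r hr)))
    (hφ.le_dilatedMoment hp hr)

theorem IsWeight.continuousOn_dilatedMoment (hφ : IsWeight φ) (hp : 0 ≤ p) :
    ContinuousOn (dilatedMoment φ p) (Set.Ico 0 1) := by
  intro r hr
  refine intervalIntegral.continuousWithinAt_of_dominated_interval (bound := fun _ => 1 / φ 0)
    ?_ ?_ (by simp) ?_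
  · filter_upwards [self_mem_nhdsWithin] with x hx
    rw [Set.uIoc_of_le zero_le_one]
    exact (hφ.intervalIntegrable_dilated hp hx).1.aestronglyMeasurable
  · filter_upwards [self_mem_nhdsWithin] with x hx
    refine Filter.Eventually.of_forall fun s hs => ?_
    rw [Set.uIoc_of_le zero_le_one] at hs
    have hs' : s ∈ Set.Icc (0 : ℝ) 1 := ⟨hs.1.le, hs.2⟩
    have hxs := IsWeight.mul_mem_Ico hx hs'
    have h0 : (0 : ℝ) ∈ Set.Ico (0 : ℝ) 1 := ⟨le_rfl, zero_lt_one⟩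
    rw [Real.norm_of_nonneg (div_nonneg (Real.rpow_nonneg hs'.1 _) (hφ.pos _ hxs).le)]
    exact div_le_div₀ zero_le_one (Real.rpow_le_one hs'.1 hs'.2 hp) (hφ.pos 0 h0)
      (hφ.monotoneOn h0 hxs hxs.1)
  · refine Filter.Eventually.of_forall fun s hs => ?_
    rw [Set.uIoc_of_le zero_le_one] at hs
    have hs' : s ∈ Set.Icc (0 : ℝ) 1 := ⟨hs.1.le, hs.2⟩
    have : ContinuousOn (fun x => φ (x * s)) (Set.Ico 0 1) :=
      hφ.continuousOn.comp (by fun_prop) fun _ hx => IsWeight.mul_mem_Ico hx hs'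
    exact (continuousOn_const.div this
      fun _ hx => (hφ.pos _ (IsWeight.mul_mem_Ico hx hs')).ne') r hr

/-- Substitution `t = r * s`. The radial form has an integrand independent of `r`, suited to
splitting and differentiation; the dilated form remains positive at `r = 0` and exposes the ratios
of values of `φ`. -/
theorem radialMoment_eq (φ : ℝ → ℝ) (hr : 0 < r) :
    radialMoment φ p r = r ^ (p + 1) * dilatedMoment φ p r := by
  have h : r • ∫ s in (0 : ℝ)..1, (r * s) ^ p / φ (r * s) = ∫ t in r * 0..r * 1, t ^ p / φ t :=
    intervalIntegral.smul_integral_comp_mul_left (fun t => t ^ p / φ t) r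
  simp only [mul_zero, mul_one, smul_eq_mul] at h
  rw [radialMoment, ← h, dilatedMoment, Real.rpow_add_one hr.ne', mul_comm (r ^ p), mul_assoc]
  congr 1
  rw [← intervalIntegral.integral_const_mul]
  apply intervalIntegral.integral_congr
  intro s hs
  rw [Set.uIcc_of_le zero_le_one] at hs
  simp only [Real.mul_rpow hr.le hs.1, mul_div_assoc]

theorem IsWeight.hasDerivAt_radialMoment (hφ : IsWeight φ) (hp : 0 ≤ p)
    (hr : r ∈ Set.Ioo (0 : ℝ) 1) :
    HasDerivAt (radialMoment φ p) (r ^ p / φ r) r := by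
  have hnhds : Set.Ioo (0 : ℝ) 1 ∈ nhds r := isOpen_Ioo.mem_nhds hr
  have hc : ContinuousOn (fun t => t ^ p / φ t) (Set.Ioo 0 1) :=
    (hφ.continuousOn_rpow_div hp).mono Set.Ioo_subset_Ico_self
  refine intervalIntegral.integral_hasDerivAt_right
    (hφ.intervalIntegrable_radial hp le_rfl hr.1.le hr.2) ?_ (hc.continuousAt hnhds)
  exact hc.stronglyMeasurableAtFilter isOpen_Ioo r hr

/-- The ratio of the moments of two orders is a non-decreasing function of the radius. -/
theorem IsWeight.radialMoment_mul_le (hφ : IsWeight φ) (hp : 0 ≤ p) {δ : ℝ} (hδ : 0 ≤ δ)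
    {a b : ℝ} (ha : 0 < a) (hab : a ≤ b) (hb : b < 1) :
    radialMoment φ (p + δ) a * radialMoment φ p b
      ≤ radialMoment φ (p + δ) b * radialMoment φ p a := by
  have hpd : 0 ≤ p + δ := by positivity
  have split : ∀ k, 0 ≤ k → radialMoment φ k b
      = radialMoment φ k a + ∫ t in a..b, t ^ k / φ t := fun k hk =>
    (intervalIntegral.integral_add_adjacent_intervals
      (hφ.intervalIntegrable_radial hk le_rfl ha.le (hab.trans_lt hb))
      (hφ.intervalIntegrable_radial hk ha.le hab hb)).symm
  -- The extra factor `t ^ δ` is at most `a ^ δ` on `[0, a]` and at least `a ^ δ` on `[a, b]`; the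
  -- product of the two integrals over `[0, a]` is common to both sides.
  have h1 : radialMoment φ (p + δ) a ≤ a ^ δ * radialMoment φ p a := by
    rw [radialMoment, radialMoment, ← intervalIntegral.integral_const_mul]
    refine intervalIntegral.integral_mono_on ha.le
      (hφ.intervalIntegrable_radial hpd le_rfl ha.le (hab.trans_lt hb))
      ((hφ.intervalIntegrable_radial hp le_rfl ha.le (hab.trans_lt hb)).const_mul _)
      fun t ht => ?_
    rw [Real.rpow_add_of_nonneg ht.1 hp hδ, mul_comm (t ^ p), mul_div_assoc]
    exact mul_le_mul_of_nonneg_right (Real.rpow_le_rpow ht.1 ht.2 hδ)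
      (div_nonneg (Real.rpow_nonneg ht.1 _)
        (hφ.pos t ⟨ht.1, ht.2.trans_lt (hab.trans_lt hb)⟩).le)
  have h2 : a ^ δ * (∫ t in a..b, t ^ p / φ t) ≤ ∫ t in a..b, t ^ (p + δ) / φ t := by
    rw [← intervalIntegral.integral_const_mul]
    refine intervalIntegral.integral_mono_on hab
      ((hφ.intervalIntegrable_radial hp ha.le hab hb).const_mul _)
      (hφ.intervalIntegrable_radial hpd ha.le hab hb) fun t ht => ?_
    have ht0 : 0 ≤ t := ha.le.trans ht.1
    rw [Real.rpow_add_of_nonneg ht0 hp hδ, mul_comm (t ^ p), mul_div_assoc]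
    exact mul_le_mul_of_nonneg_right (Real.rpow_le_rpow ha.le ht.1 hδ)
      (div_nonneg (Real.rpow_nonneg ht0 _) (hφ.pos t ⟨ht0, ht.2.trans_lt hb⟩).le)
  have h3 : 0 ≤ radialMoment φ p a := intervalIntegral.integral_nonneg ha.le fun t ht =>
    div_nonneg (Real.rpow_nonneg ht.1 _) (hφ.pos t ⟨ht.1, ht.2.trans_lt (hab.trans_lt hb)⟩).le
  have h4 : 0 ≤ ∫ t in a..b, t ^ p / φ t := intervalIntegral.integral_nonneg hab fun t ht =>
    div_nonneg (Real.rpow_nonneg (ha.le.trans ht.1) _)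
      (hφ.pos t ⟨ha.le.trans ht.1, ht.2.trans_lt hb⟩).le
  rw [split _ hpd, split _ hp]
  nlinarith [mul_le_mul_of_nonneg_right h1 h4, mul_le_mul_of_nonneg_left h2 h3]

/-- The ratio of the dilated moments of two orders is a non-increasing function of the radius. -/
theorem IsLogConvexWeight.dilatedMoment_mul_le (hφ : IsLogConvexWeight φ) (hp : 0 ≤ p) {δ : ℝ}
    (hδ : 0 < δ) {a b : ℝ} (ha : 0 ≤ a) (hab : a ≤ b) (hb : b < 1) :
    dilatedMoment φ (p + δ) b * dilatedMoment φ p a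
      ≤ dilatedMoment φ (p + δ) a * dilatedMoment φ p b := by
  have hpd : 0 ≤ p + δ := by positivity
  have ma : a ∈ Set.Ico (0 : ℝ) 1 := ⟨ha, hab.trans_lt hb⟩
  have mb : b ∈ Set.Ico (0 : ℝ) 1 := ⟨ha.trans hab, hb⟩
  have hw := hφ.toIsWeight
  have pa := hw.dilatedMoment_pos hp ma
  have pda := hw.dilatedMoment_pos hpd ma
  have hle : dilatedMoment φ (p + δ) a ≤ dilatedMoment φ p a := by
    refine intervalIntegral.integral_mono_on zero_le_one (hw.intervalIntegrable_dilated hpd ma)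
      (hw.intervalIntegrable_dilated hp ma) fun s hs => ?_
    refine div_le_div_of_nonneg_right ?_ (hφ.pos _ (IsWeight.mul_mem_Ico ma hs)).le
    rw [Real.rpow_add_of_nonneg hs.1 hp hδ.le]
    exact mul_le_of_le_one_right (Real.rpow_nonneg hs.1 _) (Real.rpow_le_one hs.1 hs.2 hδ.le)
  -- A Chebyshev argument: `s ^ δ - l` has zero mean against `s ^ p / φ (a s)` and changes sign
  -- once, at `σ`. Passing to `b` multiplies the density by `φ (a s) / φ (b s)`, which is
  -- non-increasing in `s` by log-convexity, so the mean becomes non-positive. The constant `κ` is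
  -- this factor at the sign change.
  set l := dilatedMoment φ (p + δ) a / dilatedMoment φ p a with hl
  have hl0 : 0 < l := div_pos pda pa
  have hl1 : l ≤ 1 := (div_le_one pa).2 hle
  set σ := l ^ (1 / δ) with hσ
  have hσl : σ ^ δ = l := by rw [hσ, ← Real.rpow_mul hl0.le]; field_simp; simp
  have mσ : σ ∈ Set.Icc (0 : ℝ) 1 :=
    ⟨Real.rpow_nonneg hl0.le _, Real.rpow_le_one hl0.le hl1 (by positivity)⟩
  set κ := φ (a * σ) / φ (b * σ) with hκ
  have paσ := hφ.pos _ (IsWeight.mul_mem_Ico ma mσ)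
  have pbσ := hφ.pos _ (IsWeight.mul_mem_Ico mb mσ)
  have key : dilatedMoment φ (p + δ) b - l * dilatedMoment φ p b
      ≤ κ * (dilatedMoment φ (p + δ) a - l * dilatedMoment φ p a) := by
    simp only [dilatedMoment]
    rw [← intervalIntegral.integral_const_mul, ← intervalIntegral.integral_const_mul,
      ← intervalIntegral.integral_sub (hw.intervalIntegrable_dilated hpd mb)
        ((hw.intervalIntegrable_dilated hp mb).const_mul _),
      ← intervalIntegral.integral_sub (hw.intervalIntegrable_dilated hpd ma)
        ((hw.intervalIntegrable_dilated hp ma).const_mul _),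
      ← intervalIntegral.integral_const_mul]
    refine intervalIntegral.integral_mono_on zero_le_one
      ((hw.intervalIntegrable_dilated hpd mb).sub
        ((hw.intervalIntegrable_dilated hp mb).const_mul _))
      (((hw.intervalIntegrable_dilated hpd ma).sub
        ((hw.intervalIntegrable_dilated hp ma).const_mul _)).const_mul _) fun s hs => ?_
    have pas := hφ.pos _ (IsWeight.mul_mem_Ico ma hs)
    have pbs := hφ.pos _ (IsWeight.mul_mem_Ico mb hs)
    have e1 : s ^ (p + δ) / φ (b * s) - l * (s ^ p / φ (b * s))
        = s ^ p * ((s ^ δ - l) * (1 / φ (b * s))) := by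
      rw [Real.rpow_add_of_nonneg hs.1 hp hδ.le]; ring
    have e2 : κ * (s ^ (p + δ) / φ (a * s) - l * (s ^ p / φ (a * s)))
        = s ^ p * ((s ^ δ - l) * (κ / φ (a * s))) := by
      rw [Real.rpow_add_of_nonneg hs.1 hp hδ.le]; ring
    rw [e1, e2]
    refine mul_le_mul_of_nonneg_left ?_ (Real.rpow_nonneg hs.1 _)
    rw [hκ, div_div]
    rcases le_total s σ with h | h
    · have h1 : s ^ δ - l ≤ 0 := by
        rw [← hσl]; linarith [Real.rpow_le_rpow hs.1 h hδ.le]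
      refine mul_le_mul_of_nonpos_left ?_ h1
      rw [div_le_div_iff₀ (by positivity) (by positivity)]
      have := hφ.mul_le_mul ha hab hs.1 h (IsWeight.mul_mem_Ico mb mσ).2
      linarith
    · have h1 : 0 ≤ s ^ δ - l := by
        rw [← hσl]; linarith [Real.rpow_le_rpow mσ.1 h hδ.le]
      refine mul_le_mul_of_nonneg_left ?_ h1
      rw [div_le_div_iff₀ (by positivity) (by positivity)]
      have := hφ.mul_le_mul ha hab mσ.1 h (IsWeight.mul_mem_Ico mb hs).2
      linarith
  have e : dilatedMoment φ (p + δ) a - l * dilatedMoment φ p a = 0 := by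
    rw [hl]; field_simp; simp
  rw [e, mul_zero] at key
  have : dilatedMoment φ (p + δ) a = l * dilatedMoment φ p a := by linarith
  rw [this]
  nlinarith

/-- The radial moment of a log-convex weight is log-concave in the logarithm of the radius. -/
theorem IsLogConvexWeight.concaveOn_log_radialMoment (hφ : IsLogConvexWeight φ) (hp : 0 ≤ p) :
    ConcaveOn ℝ (Set.Iio (0 : ℝ)) (fun x => Real.log (radialMoment φ p (Real.exp x))) := by
  have hw := hφ.toIsWeight
  have mem : ∀ x ∈ Set.Iio (0 : ℝ), Real.exp x ∈ Set.Ioo (0 : ℝ) 1 := fun x hx =>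
    ⟨Real.exp_pos x, Real.exp_lt_one_iff.2 hx⟩
  -- With `r = exp x`, the derivative is `r * (r ^ p / φ r)` over the radial moment; the powers of
  -- `r` cancel once the latter is written in dilated form.
  have hd : ∀ x ∈ Set.Iio (0 : ℝ), HasDerivAt
      (fun x => Real.log (radialMoment φ p (Real.exp x)))
      (1 / (φ (Real.exp x) * dilatedMoment φ p (Real.exp x))) x := by
    intro x hx
    have hm := mem x hx
    have hJ := hw.dilatedMoment_pos hp ⟨hm.1.le, hm.2⟩
    have hK : radialMoment φ p (Real.exp x) ≠ 0 := by
      rw [radialMoment_eq φ hm.1]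
      exact (mul_pos (Real.rpow_pos_of_pos hm.1 _) hJ).ne'
    have := ((hw.hasDerivAt_radialMoment hp hm).comp x (Real.hasDerivAt_exp x)).log hK
    refine this.congr_deriv ?_
    rw [Function.comp_apply]
    have hφ0 := hφ.pos _ ⟨hm.1.le, hm.2⟩
    rw [radialMoment_eq φ hm.1, Real.rpow_add_one hm.1.ne']
    have := Real.rpow_pos_of_pos hm.1 p
    have := hm.1
    field_simp
  refine AntitoneOn.concaveOn_of_deriv (convex_Iio 0)
    (fun x hx => (hd x hx).continuousAt.continuousWithinAt)
    (fun x hx => (hd x (interior_subset hx)).differentiableAt.differentiableWithinAt) ?_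
  rw [interior_Iio]
  intro x hx y hy hxy
  rw [(hd x hx).deriv, (hd y hy).deriv]
  have mx := mem x hx
  have my := mem y hy
  have hxy' : Real.exp x ≤ Real.exp y := Real.exp_le_exp.2 hxy
  have mx' : Real.exp x ∈ Set.Ico (0 : ℝ) 1 := ⟨mx.1.le, mx.2⟩
  have my' : Real.exp y ∈ Set.Ico (0 : ℝ) 1 := ⟨my.1.le, my.2⟩
  -- The denominator is the integral of `s ^ p * (φ r / φ (r s))`, and `φ r / φ (r s)` is
  -- non-decreasing in `r` by log-convexity.
  refine one_div_le_one_div_of_le (mul_pos (hφ.pos _ mx') (hw.dilatedMoment_pos hp mx')) ?_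
  rw [dilatedMoment, dilatedMoment, ← intervalIntegral.integral_const_mul,
    ← intervalIntegral.integral_const_mul]
  refine intervalIntegral.integral_mono_on zero_le_one
    ((hw.intervalIntegrable_dilated hp mx').const_mul _)
    ((hw.intervalIntegrable_dilated hp my').const_mul _) fun s hs => ?_
  have h := hφ.mul_le_mul mx.1.le hxy' hs.1 hs.2 (by simpa using my.2)
  simp only [mul_one] at h
  have pxs := hφ.pos _ (IsWeight.mul_mem_Ico mx' hs)
  have pys := hφ.pos _ (IsWeight.mul_mem_Ico my' hs)
  have : 0 ≤ s ^ p := Real.rpow_nonneg hs.1 _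
  rw [mul_div_left_comm, mul_div_left_comm (φ (Real.exp y))]
  refine mul_le_mul_of_nonneg_left ?_ this
  rw [div_le_div_iff₀ pxs pys]
  linarith

end Moments

/-! ### Peaked sequences and the choice of sparse indices -/

/-- A sequence of functions on `[0, 1)` with values in `[0, 1]`, the `n`-th of which attains the
value `1` at the point `y n`. The quotients of consecutive functions are non-decreasing, but
grow at most like `r ^ q`. -/
structure IsPeakedSequence (q : ℝ) (τ : ℕ → ℝ → ℝ) (y : ℕ → ℝ) : Prop where
  nonneg : ∀ n, ∀ r ∈ Set.Ico (0 : ℝ) 1, 0 ≤ τ n r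
  le_one : ∀ n, ∀ r ∈ Set.Ico (0 : ℝ) 1, τ n r ≤ 1
  peak : ∀ n, τ n (y n) = 1
  mem : ∀ n, y n ∈ Set.Ico (0 : ℝ) 1
  mono : Monotone y
  zero : y 0 = 0
  one_pos : 0 < y 1
  pos : 0 < τ 0 (y 1)
  eq_zero : ∀ n, 0 < n → τ n 0 = 0
  cross : ∀ m n, m ≤ n → ∀ a ∈ Set.Ico (0 : ℝ) 1, ∀ b ∈ Set.Ico (0 : ℝ) 1, a ≤ b →
    τ n a * τ m b ≤ τ n b * τ m a
  growth : ∀ n, ∀ a ∈ Set.Ico (0 : ℝ) 1, ∀ b ∈ Set.Ico (0 : ℝ) 1, a ≤ b →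
    a ^ q * (τ (n + 1) b * τ n a) ≤ b ^ q * (τ (n + 1) a * τ n b)
  quasiconcave : ∀ n, ∀ a ∈ Set.Ico (0 : ℝ) 1, ∀ b ∈ Set.Ico (0 : ℝ) 1, ∀ r, a ≤ r → r ≤ b →
    ∀ ε, ε ≤ τ n a → ε ≤ τ n b → ε ≤ τ n r
  tendsto_peak : Filter.Tendsto y Filter.atTop (nhds 1)
  tendsto_zero : ∀ r ∈ Set.Ico (0 : ℝ) 1, Filter.Tendsto (fun n => τ n r) Filter.atTop (nhds 0)
  tendsto_boundary : ∀ n, Filter.Tendsto (fun m => τ n (y m)) Filter.atTop (nhds 0)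

namespace IsPeakedSequence

variable {q : ℝ} {τ : ℕ → ℝ → ℝ} {y : ℕ → ℝ}

/-- The growth condition between `r` and the peak `y (n + 1)`, where `τ (n + 1)` is `1`. The
restriction `y 1 ≤ r` keeps `r ^ q` away from `0`. With `r = y n` it compares neighbours at both
peaks. -/
theorem rpow_le (h : IsPeakedSequence q τ y) (hq : 0 < q) {n : ℕ} {r : ℝ} (hr : y 1 ≤ r)
    (hrn : r ≤ y (n + 1)) : y 1 ^ q * τ n r ≤ τ (n + 1) r * τ n (y (n + 1)) := by
  have mr : r ∈ Set.Ico (0 : ℝ) 1 := ⟨h.one_pos.le.trans hr, hrn.trans_lt (h.mem _).2⟩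
  have g := h.growth n r mr _ (h.mem (n + 1)) hrn
  rw [h.peak, one_mul] at g
  have h1 : y 1 ^ q ≤ r ^ q := Real.rpow_le_rpow h.one_pos.le hr hq.le
  have h2 : y (n + 1) ^ q ≤ 1 := Real.rpow_le_one (h.mem _).1 (h.mem _).2.le hq.le
  calc y 1 ^ q * τ n r ≤ r ^ q * τ n r := mul_le_mul_of_nonneg_right h1 (h.nonneg n r mr)
    _ ≤ _ := g
    _ ≤ 1 * (τ (n + 1) r * τ n (y (n + 1))) := mul_le_mul_of_nonneg_right h2
        (mul_nonneg (h.nonneg _ _ mr) (h.nonneg _ _ (h.mem _)))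
    _ = _ := one_mul _

theorem rpow_mul_le (h : IsPeakedSequence q τ y) (hq : 0 < q) {n : ℕ} {r : ℝ} (hr : y 1 ≤ r)
    (hrn : r ≤ y (n + 1)) : y 1 ^ q * τ n r ≤ τ (n + 1) r :=
  (h.rpow_le hq hr hrn).trans (mul_le_of_le_one_right
    (h.nonneg _ _ ⟨h.one_pos.le.trans hr, hrn.trans_lt (h.mem _).2⟩) (h.le_one _ _ (h.mem _)))

/-- The `n`-th function is not small at the next peak. -/
theorem le_next_peak (h : IsPeakedSequence q τ y) (hq : 0 < q) (n : ℕ) :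
    min (y 1 ^ q) (τ 0 (y 1)) ≤ τ n (y (n + 1)) := by
  rcases Nat.eq_zero_or_pos n with rfl | hn
  · exact min_le_right _ _
  · refine (min_le_left _ _).trans ?_
    have := h.rpow_le hq (n := n) (h.mono (Nat.succ_le_of_lt hn)) (h.mono (Nat.le_succ n))
    rw [h.peak, mul_one] at this
    exact this.trans (mul_le_of_le_one_left (h.nonneg _ _ (h.mem _)) (h.le_one _ _ (h.mem _)))

/-- For `n ≥ 1`, the `(n + 1)`-th function is not small between its peak and the previous one. -/
theorem le_between (h : IsPeakedSequence q τ y) (hq : 0 < q) {n : ℕ} (hn : 0 < n) {r : ℝ}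
    (hr : y n ≤ r) (hr' : r ≤ y (n + 1)) :
    min (y 1 ^ q) (τ 0 (y 1)) ≤ τ (n + 1) r := by
  have h0 : y 1 ^ q ≤ 1 := Real.rpow_le_one (h.mem 1).1 (h.mem 1).2.le hq.le
  refine (min_le_left _ _).trans (h.quasiconcave (n + 1) _ (h.mem n) _ (h.mem (n + 1)) r hr hr' _
    ?_ (by rwa [h.peak]))
  have := h.rpow_mul_le hq (n := n) (h.mono (Nat.succ_le_of_lt hn)) (h.mono (Nat.le_succ n))
  rwa [h.peak, mul_one] at this

theorem exists_next (h : IsPeakedSequence q τ y) {ε : ℝ} (hε : 0 < ε) (n : ℕ) :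
    ∃ m, n < m ∧ τ n (y m) ≤ ε ∧ τ m (y n) ≤ ε := by
  have h1 := (h.tendsto_boundary n).eventually (eventually_le_nhds hε)
  have h2 := (h.tendsto_zero _ (h.mem n)).eventually (eventually_le_nhds hε)
  obtain ⟨m, hm⟩ := ((Filter.eventually_gt_atTop n).and (h1.and h2)).exists
  exact ⟨m, hm.1, hm.2.1, hm.2.2⟩

/-- A sparse subsequence of a peaked sequence: at each point, one of two consecutive members is
bounded below, and the others decay geometrically with the distance of their index to these. -/
theorem exists_sparse (h : IsPeakedSequence q τ y) (hq : 0 < q) {η : ℝ} (hη : 0 < η) :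
    ∃ n : ℕ → ℕ, StrictMono n ∧ n 0 = 0 ∧ ∃ δ : ℝ, 0 < δ ∧ ∀ r ∈ Set.Ico (0 : ℝ) 1, ∃ k,
      (δ ≤ τ (n k) r ∨ δ ≤ τ (n (k + 1)) r) ∧
      (∀ j, k + 1 ≤ j → τ (n (j + 1)) r ≤ η * τ (n j) r) ∧
      ∀ j, j < k → τ (n j) r ≤ η * τ (n (j + 1)) r := by
  classical
  obtain ⟨c, hc⟩ : ∃ c, c = min (y 1 ^ q) (τ 0 (y 1)) := ⟨_, rfl⟩
  have hc0 : 0 < c := by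
    rw [hc]
    exact lt_min (Real.rpow_pos_of_pos h.one_pos _) h.pos
  have hcq : c ≤ y 1 ^ q := hc ▸ min_le_left _ _
  have hc1 : c ≤ 1 := hcq.trans (Real.rpow_le_one (h.mem 1).1 (h.mem 1).2.le hq.le)
  -- The bound `ε ≤ η` gives the decay; `ε < c` prevents the choice of two adjacent indices, since
  -- neighbours are at least `c` at the next peak.
  obtain ⟨ε, hε, hεη, hεc⟩ : ∃ ε, 0 < ε ∧ ε ≤ η ∧ ε < c :=
    ⟨min η (c / 2), lt_min hη (by positivity), min_le_left _ _,
      (min_le_right _ _).trans_lt (by linarith)⟩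
  -- The greedy rule takes the least later index that is small at the old peak and at whose peak the
  -- old function is small.
  let good : ℕ → ℕ → Prop := fun n m => n < m ∧ τ n (y m) ≤ ε ∧ τ m (y n) ≤ ε
  have hex : ∀ n, ∃ m, good n m := fun n => h.exists_next hε n
  let next : ℕ → ℕ := fun n => Nat.find (hex n)
  have hnext : ∀ n, good n (next n) := fun n => Nat.find_spec (hex n)
  have hmin : ∀ n m, m < next n → ¬ good n m := fun n m hm => Nat.find_min (hex n) hm
  let s : ℕ → ℕ := fun k => next^[k] 0
  have hs : ∀ k, s (k + 1) = next (s k) := fun k => Function.iterate_succ_apply' next k 0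
  have hsm : StrictMono s := strictMono_nat_of_lt_succ fun k => by
    rw [hs]; exact (hnext _).1
  have hsg : ∀ k, good (s k) (s (k + 1)) := fun k => by rw [hs]; exact hnext _
  refine ⟨s, hsm, rfl, c * ε, by positivity, fun r hr => ?_⟩
  have hrk : ∃ k, r < y (s k) := by
    have := (h.tendsto_peak.comp hsm.tendsto_atTop).eventually (eventually_gt_nhds hr.2)
    exact this.exists
  obtain ⟨k, hk1, hk2⟩ : ∃ k, y (s k) ≤ r ∧ r < y (s (k + 1)) := by
    have h0 : Nat.find hrk ≠ 0 := by
      intro h0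
      have := Nat.find_spec hrk
      rw [h0] at this
      change r < y 0 at this
      rw [h.zero] at this
      exact absurd hr.1 (not_le.2 this)
    obtain ⟨k, hk⟩ := Nat.exists_eq_succ_of_ne_zero h0
    refine ⟨k, ?_, ?_⟩
    · exact not_lt.1 (Nat.find_min hrk (by omega))
    · have := Nat.find_spec hrk
      rwa [hk] at this
  refine ⟨k, ?_, fun j hj => ?_, fun j hj => ?_⟩
  · have hg := hsg k
    -- The predecessor `p` of the chosen index was rejected. The failed condition, carried over `[y
    -- (s k), y p]` by quasiconcavity, provides the lower bound.
    obtain ⟨p, hp⟩ : ∃ p, s (k + 1) = p + 1 :=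
      Nat.exists_eq_succ_of_ne_zero (Nat.ne_of_gt (Nat.zero_lt_of_lt hg.1))
    rw [hp] at hg hk2 ⊢
    have hpn : s k ≠ p := by
      intro hkp
      have h1 := h.le_next_peak hq p
      have h2 := hg.2.1
      rw [hkp] at h2
      rw [← hc] at h1
      linarith
    have hlt : s k < p := lt_of_le_of_ne (Nat.lt_succ_iff.1 hg.1) hpn
    have hcε : c * ε ≤ ε := mul_le_of_le_one_left hε.le hc1
    rcases le_total (y p) r with hpr | hpr
    · right
      have := h.le_between hq (Nat.zero_lt_of_lt hlt) hpr hk2.le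
      rw [← hc] at this
      linarith
    have hbad : ¬ good (s k) p := hmin _ _ (by rw [← hs, hp]; exact Nat.lt_succ_self p)
    have hbad' : ε < τ (s k) (y p) ∨ ε < τ p (y (s k)) := by
      by_contra! hcon
      exact hbad ⟨hlt, hcon⟩
    rcases hbad' with hb | hb
    · left
      refine hcε.trans (h.quasiconcave _ _ (h.mem _) _ (h.mem p) r hk1 hpr ε ?_ hb.le)
      rw [h.peak]; linarith
    · right
      -- The comparison of `τ p` with `τ (p + 1)` needs `y 1 ≤ r`. The first index is excluded here
      -- because `τ p` vanishes at `y 0 = 0`.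
      have hk0 : 0 < s k := by
        rcases Nat.eq_zero_or_pos (s k) with h0 | h0
        · rw [h0, h.zero, h.eq_zero p (Nat.zero_lt_of_lt hlt)] at hb
          exact absurd hb (not_lt.2 hε.le)
        · exact h0
      have h1 : ε ≤ τ p r := by
        refine h.quasiconcave _ _ (h.mem _) _ (h.mem p) r hk1 hpr ε hb.le ?_
        rw [h.peak]; linarith
      have h2 := h.rpow_mul_le hq (n := p) ((h.mono (Nat.succ_le_of_lt hk0)).trans hk1) hk2.le
      calc c * ε ≤ y 1 ^ q * τ p r := mul_le_mul hcq h1 hε.le (hc0.le.trans hcq)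
        _ ≤ _ := h2
  -- To the left of the peak `y (s j)`, the monotone quotient `τ (s (j + 1)) / τ (s j)` is at most
  -- its value at that peak, hence at most `ε`. The next case is symmetric.
  · have hg := hsg j
    have hrj : r ≤ y (s j) := hk2.le.trans (h.mono (hsm.monotone hj))
    have := h.cross _ _ (hsm.monotone (Nat.le_succ j)) r hr _ (h.mem _) hrj
    rw [h.peak, mul_one] at this
    refine this.trans (mul_le_mul_of_nonneg_right (hg.2.2.trans hεη) (h.nonneg _ _ hr))
  · have hg := hsg j
    have hrj : y (s (j + 1)) ≤ r := (h.mono (hsm.monotone hj)).trans hk1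
    have := h.cross _ _ (hsm.monotone (Nat.le_succ j)) _ (h.mem (s (j + 1))) r hr hrj
    rw [h.peak, one_mul] at this
    refine (this.trans_eq (mul_comm _ _)).trans ?_
    exact mul_le_mul_of_nonneg_right (hg.2.1.trans hεη) (h.nonneg _ _ hr)

end IsPeakedSequence

/-! ### Weighted means of monomials -/

/-- Up to a constant factor, the weighted volume mean of `|z₁| ^ (n q)` with weight `1 / φ`. -/
noncomputable def monomialMean (φ : ℝ → ℝ) (d : ℕ) (q : ℝ) (n : ℕ) (r : ℝ) : ℝ :=
  r ^ (n * q) * dilatedMoment φ (n * q + (2 * d - 1)) r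

section MonomialMean

variable {φ W : ℝ → ℝ} {d : ℕ} {q : ℝ} {n : ℕ} {r : ℝ}

theorem monomialMean_exponent_nonneg (hd : 1 ≤ d) (hq : 0 < q) (n : ℕ) :
    0 ≤ n * q + (2 * d - 1) := by
  have : (1 : ℝ) ≤ d := by exact_mod_cast hd
  have : (0 : ℝ) ≤ n * q := by positivity
  linarith

theorem monomialMean_eq (φ : ℝ → ℝ) (d : ℕ) (q : ℝ) (n : ℕ) (hr : 0 < r) :
    monomialMean φ d q n r = radialMoment φ (n * q + (2 * d - 1)) r / r ^ (2 * d) := by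
  rw [monomialMean, radialMoment_eq φ hr,
    show (n : ℝ) * q + (2 * d - 1) + 1 = n * q + (2 * d : ℕ) by push_cast; ring,
    Real.rpow_add_natCast hr.ne']
  have : r ^ (2 * d) ≠ 0 := by positivity
  field_simp

theorem IsWeight.monomialMean_pos (hφ : IsWeight φ) (hd : 1 ≤ d) (hq : 0 < q)
    (hr : r ∈ Set.Ico (0 : ℝ) 1) (hn : 0 < r ∨ n = 0) : 0 < monomialMean φ d q n r := by
  refine mul_pos ?_ (hφ.dilatedMoment_pos (monomialMean_exponent_nonneg hd hq n) hr)
  rcases hn with hn | rfl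
  · exact Real.rpow_pos_of_pos hn _
  · simp

theorem monomialMean_zero_right (φ : ℝ → ℝ) (d : ℕ) (hq : 0 < q) (hn : 0 < n) :
    monomialMean φ d q n 0 = 0 := by
  have : (n : ℝ) * q ≠ 0 := by positivity
  simp [monomialMean, Real.zero_rpow this]

theorem IsWeight.monomialMean_nonneg (hφ : IsWeight φ) (hd : 1 ≤ d) (hq : 0 < q)
    (hr : r ∈ Set.Ico (0 : ℝ) 1) : 0 ≤ monomialMean φ d q n r :=
  mul_nonneg (Real.rpow_nonneg hr.1 _)
    (hφ.dilatedMoment_pos (monomialMean_exponent_nonneg hd hq n) hr).le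

theorem IsWeight.continuousOn_monomialMean (hφ : IsWeight φ) (hd : 1 ≤ d) (hq : 0 < q) (n : ℕ) :
    ContinuousOn (monomialMean φ d q n) (Set.Ico 0 1) :=
  (Real.continuous_rpow_const (by positivity)).continuousOn.mul
    (hφ.continuousOn_dilatedMoment (monomialMean_exponent_nonneg hd hq n))

theorem IsWeight.monomialMean_le (hφ : IsWeight φ) (hd : 1 ≤ d) (hq : 0 < q)
    (hr : r ∈ Set.Ico (0 : ℝ) 1) :
    monomialMean φ d q n r ≤ r ^ (n * q) * (1 / ((n * q + (2 * d - 1) + 1) * φ 0)) :=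
  mul_le_mul_of_nonneg_left
    (hφ.dilatedMoment_le (monomialMean_exponent_nonneg hd hq n) hr) (Real.rpow_nonneg hr.1 _)

theorem IsWeight.le_monomialMean (hφ : IsWeight φ) (hd : 1 ≤ d) (hq : 0 < q)
    (hr : r ∈ Set.Ico (0 : ℝ) 1) :
    r ^ (n * q) * (1 / ((n * q + (2 * d - 1) + 1) * φ r)) ≤ monomialMean φ d q n r :=
  mul_le_mul_of_nonneg_left
    (hφ.le_dilatedMoment (monomialMean_exponent_nonneg hd hq n) hr) (Real.rpow_nonneg hr.1 _)

theorem IsWeight.monomialMean_cross (hφ : IsWeight φ) (hd : 1 ≤ d) (hq : 0 < q) {m n : ℕ}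
    (hmn : m ≤ n) {a b : ℝ} (ha : a ∈ Set.Ico (0 : ℝ) 1) (hb : b ∈ Set.Ico (0 : ℝ) 1)
    (hab : a ≤ b) :
    monomialMean φ d q n a * monomialMean φ d q m b
      ≤ monomialMean φ d q n b * monomialMean φ d q m a := by
  rcases hmn.eq_or_lt with rfl | hlt
  · rw [mul_comm]
  rcases ha.1.eq_or_lt with h0 | h0
  · rw [← h0, monomialMean_zero_right φ d hq (Nat.zero_lt_of_lt hlt), zero_mul]
    exact mul_nonneg (hφ.monomialMean_nonneg hd hq hb)
      (hφ.monomialMean_nonneg hd hq ⟨le_rfl, zero_lt_one⟩)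
  · have hb0 := h0.trans_le hab
    rw [monomialMean_eq φ d q n h0, monomialMean_eq φ d q m h0, monomialMean_eq φ d q n hb0,
      monomialMean_eq φ d q m hb0, div_mul_div_comm, div_mul_div_comm, mul_comm (b ^ _)]
    refine div_le_div_of_nonneg_right ?_ (by positivity)
    have h := hφ.radialMoment_mul_le (monomialMean_exponent_nonneg hd hq m)
      (δ := (n - m) * q) (mul_nonneg (sub_nonneg.2 (by exact_mod_cast hmn)) hq.le) h0 hab hb.2
    have e : (m : ℝ) * q + (2 * d - 1) + (n - m) * q = n * q + (2 * d - 1) := by ring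
    rwa [e] at h

/-- Raising the degree by one multiplies the power of the radius by `r ^ q` and raises the order of
the moment by `q`; the ratio of the moments is non-increasing. -/
theorem IsLogConvexWeight.monomialMean_growth (hφ : IsLogConvexWeight φ) (hd : 1 ≤ d)
    (hq : 0 < q) (n : ℕ) {a b : ℝ} (ha : a ∈ Set.Ico (0 : ℝ) 1) (hb : b ∈ Set.Ico (0 : ℝ) 1)
    (hab : a ≤ b) :
    a ^ q * (monomialMean φ d q (n + 1) b * monomialMean φ d q n a)
      ≤ b ^ q * (monomialMean φ d q (n + 1) a * monomialMean φ d q n b) := by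
  have h := hφ.dilatedMoment_mul_le (monomialMean_exponent_nonneg hd hq n) hq ha.1 hab hb.2
  have e : (n : ℝ) * q + (2 * d - 1) + q = (n + 1 : ℕ) * q + (2 * d - 1) := by push_cast; ring
  rw [e] at h
  have e2 : ∀ x : ℝ, 0 ≤ x → x ^ (((n + 1 : ℕ) : ℝ) * q) = x ^ ((n : ℝ) * q) * x ^ q := by
    intro x hx
    rw [← Real.rpow_add_of_nonneg hx (by positivity) hq.le]
    congr 1
    push_cast
    ring
  simp only [monomialMean]
  rw [e2 a ha.1, e2 b hb.1]
  have hpos : 0 ≤ a ^ q * b ^ q * a ^ ((n : ℝ) * q) * b ^ ((n : ℝ) * q) := by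
    have := ha.1; have := hb.1; positivity
  calc _ = (a ^ q * b ^ q * a ^ ((n : ℝ) * q) * b ^ ((n : ℝ) * q)) *
        (dilatedMoment φ ((n + 1 : ℕ) * q + (2 * d - 1)) b *
          dilatedMoment φ (n * q + (2 * d - 1)) a) := by ring
    _ ≤ _ := mul_le_mul_of_nonneg_left h hpos
    _ = _ := by ring

theorem IsLogConvexWeight.monomialMean_div_quasiconcave (hφ : IsLogConvexWeight φ)
    (hW : IsLogConvexWeight W) (hd : 1 ≤ d) (hq : 0 < q) (n : ℕ) {a b r : ℝ}
    (ha : a ∈ Set.Ico (0 : ℝ) 1) (hb : b ∈ Set.Ico (0 : ℝ) 1) (har : a ≤ r) (hrb : r ≤ b) :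
    min (monomialMean φ d q n a / W a) (monomialMean φ d q n b / W b)
      ≤ monomialMean φ d q n r / W r := by
  have hw := hφ.toIsWeight
  have hr : r ∈ Set.Ico (0 : ℝ) 1 := ⟨ha.1.trans har, hrb.trans_lt hb.2⟩
  -- At `a = 0` the logarithm is unavailable: for `n = 0` the quotient is non-increasing on `[r,
  -- b]`, and for `n > 0` it vanishes at `0`.
  rcases ha.1.eq_or_lt with h0 | h0
  · rcases Nat.eq_zero_or_pos n with rfl | hn
    · refine (min_le_right _ _).trans ?_
      have hJ := hw.dilatedMoment_anti (monomialMean_exponent_nonneg hd hq 0) hr hb hrb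
      simp only [monomialMean, Nat.cast_zero, zero_mul, Real.rpow_zero, one_mul] at hJ ⊢
      refine div_le_div₀ ?_ hJ (hW.pos _ hr) (hW.monotoneOn hr hb hrb)
      have := (hw.dilatedMoment_pos (monomialMean_exponent_nonneg hd hq 0) hr).le
      simpa using this
    · refine (min_le_left _ _).trans ?_
      rw [← h0, monomialMean_zero_right φ d hq hn, zero_div]
      exact div_nonneg (hw.monomialMean_nonneg hd hq hr) (hW.pos _ hr).le
  have hp := monomialMean_exponent_nonneg hd hq n
  -- In the variable `log x` this is a concave function, minus a convex one, plus a linear one.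
  have key : ∀ x ∈ Set.Ioo (0 : ℝ) 1, Real.log (monomialMean φ d q n x / W x)
      = Real.log (radialMoment φ (n * q + (2 * d - 1)) (Real.exp (Real.log x)))
        + (-(Real.log (W (Real.exp (Real.log x)))) + (-(2 * d) : ℝ) * Real.log x) := by
    intro x hx
    have hx' : x ∈ Set.Ico (0 : ℝ) 1 := ⟨hx.1.le, hx.2⟩
    have hF := hw.monomialMean_pos (n := n) hd hq hx' (Or.inl hx.1)
    have hK : radialMoment φ (n * q + (2 * d - 1)) x ≠ 0 := by
      rw [radialMoment_eq φ hx.1]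
      exact (mul_pos (Real.rpow_pos_of_pos hx.1 _) (hw.dilatedMoment_pos hp hx')).ne'
    rw [Real.exp_log hx.1, Real.log_div hF.ne' (hW.pos _ hx').ne', monomialMean_eq φ d q n hx.1,
      Real.log_div hK (pow_pos hx.1 _).ne', Real.log_pow]
    push_cast
    ring
  have hlin : ConcaveOn ℝ (Set.Iio (0 : ℝ)) (fun x : ℝ => (-(2 * d) : ℝ) * x) :=
    ⟨convex_Iio 0, fun x _ y _ u v _ _ _ => by
      simp only [smul_eq_mul]; exact le_of_eq (by ring)⟩
  have hconc := (hφ.concaveOn_log_radialMoment hp).add (hW.logConvex.neg.add hlin)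
  have hlog : ∀ x ∈ Set.Ioo (0 : ℝ) 1, Real.log x ∈ Set.Iio (0 : ℝ) := fun x hx =>
    Real.log_neg hx.1 hx.2
  have hr0 := h0.trans_le har
  have ma : a ∈ Set.Ioo (0 : ℝ) 1 := ⟨h0, ha.2⟩
  have mb : b ∈ Set.Ioo (0 : ℝ) 1 := ⟨hr0.trans_le hrb, hb.2⟩
  have mr : r ∈ Set.Ioo (0 : ℝ) 1 := ⟨hr0, hr.2⟩
  have h := hconc.min_le_of_mem_Icc (hlog a ma) (hlog b mb) (z := Real.log r)
    ⟨Real.log_le_log h0 har, Real.log_le_log hr0 hrb⟩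
  simp only [Pi.add_apply, Pi.neg_apply] at h
  rw [← key a ma, ← key b mb, ← key r mr] at h
  have pos : ∀ x ∈ Set.Ioo (0 : ℝ) 1, 0 < monomialMean φ d q n x / W x := fun x hx =>
    div_pos (hw.monomialMean_pos hd hq ⟨hx.1.le, hx.2⟩ (Or.inl hx.1)) (hW.pos _ ⟨hx.1.le, hx.2⟩)
  rcases min_le_iff.1 h with h | h
  · exact min_le_iff.2 (Or.inl ((Real.log_le_log_iff (pos a ma) (pos r mr)).1 h))
  · exact min_le_iff.2 (Or.inr ((Real.log_le_log_iff (pos b mb) (pos r mr)).1 h))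

/-- The quotients `F n r / F n b` for `r ≤ a < b` decay geometrically in `n`. -/
theorem IsWeight.monomialMean_div_le (hφ : IsWeight φ) (hW : IsWeight W) (hd : 1 ≤ d)
    (hq : 0 < q) (n : ℕ) {a b : ℝ} (ha : a ∈ Set.Ico (0 : ℝ) 1) (hb : b ∈ Set.Ico (0 : ℝ) 1)
    (hab : a < b) (hr : 0 ≤ r) (hra : r ≤ a) :
    monomialMean φ d q n r / W r ≤ (φ b * W b / (φ 0 * W 0)) * ((a / b) ^ q) ^ n *
      (monomialMean φ d q n b / W b) := by
  have mr : r ∈ Set.Ico (0 : ℝ) 1 := ⟨hr, hra.trans_lt ha.2⟩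
  have m0 : (0 : ℝ) ∈ Set.Ico (0 : ℝ) 1 := ⟨le_rfl, zero_lt_one⟩
  have hb0 : 0 < b := ha.1.trans_lt hab
  have h1 := hφ.monomialMean_le (n := n) hd hq mr
  have h2 := hφ.le_monomialMean (n := n) hd hq hb
  have pφ0 := hφ.pos 0 m0
  have pφb := hφ.pos b hb
  have pW0 := hW.pos 0 m0
  have pWb := hW.pos b hb
  have hW0r := hW.monotoneOn m0 mr hr
  have hp := monomialMean_exponent_nonneg hd hq n
  have hra' : r ^ ((n : ℝ) * q) ≤ a ^ ((n : ℝ) * q) := Real.rpow_le_rpow hr hra (by positivity)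
  have ha' : 0 ≤ a ^ ((n : ℝ) * q) := Real.rpow_nonneg ha.1 _
  have hbq : 0 < b ^ ((n : ℝ) * q) := Real.rpow_pos_of_pos hb0 _
  have e : ((a / b) ^ q) ^ n = a ^ ((n : ℝ) * q) / b ^ ((n : ℝ) * q) := by
    rw [← Real.rpow_natCast, ← Real.rpow_mul (div_nonneg ha.1 hb0.le),
      Real.div_rpow ha.1 hb0.le, mul_comm q]
  have hp1 : 0 < (n : ℝ) * q + (2 * d - 1) + 1 := by linarith
  -- The factor `1 / (n q + 2 d)` occurs both in the upper bound at `r` and in the lower bound at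
  -- `b`, so it cancels.
  calc monomialMean φ d q n r / W r
      ≤ (a ^ ((n : ℝ) * q) * (1 / ((n * q + (2 * d - 1) + 1) * φ 0))) / W 0 :=
        div_le_div₀ (by positivity)
          (h1.trans (mul_le_mul_of_nonneg_right hra' (by positivity))) pW0 hW0r
    _ = (φ b * W b / (φ 0 * W 0)) * (a ^ ((n : ℝ) * q) / b ^ ((n : ℝ) * q)) *
        ((b ^ ((n : ℝ) * q) * (1 / ((n * q + (2 * d - 1) + 1) * φ b))) / W b) := by
        field_simp
    _ ≤ _ := by
        rw [e]
        refine mul_le_mul_of_nonneg_left (div_le_div_of_nonneg_right h2 pWb.le) ?_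
        positivity

/-- Near `1` the function is below one of its positive values, so the supremum is sought on a
compact interval. -/
theorem exists_isMaxOn_Ico {ρ : ℝ → ℝ} (hρ : ContinuousOn ρ (Set.Ico 0 1))
    (hlim : ∀ ε : ℝ, 0 < ε → ∃ b ∈ Set.Ico (0 : ℝ) 1, ∀ r ∈ Set.Ico (0 : ℝ) 1, b ≤ r → ρ r ≤ ε)
    {a : ℝ} (ha : a ∈ Set.Ico (0 : ℝ) 1) (hpos : ∃ r ∈ Set.Ico (0 : ℝ) 1, a ≤ r ∧ 0 < ρ r) :
    ∃ y ∈ Set.Ico (0 : ℝ) 1, a ≤ y ∧ ∀ r ∈ Set.Ico (0 : ℝ) 1, a ≤ r → ρ r ≤ ρ y := by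
  obtain ⟨r₀, hr₀, har₀, hpr₀⟩ := hpos
  obtain ⟨b, hb, hbound⟩ := hlim _ hpr₀
  have hsub : Set.Icc a (max b r₀) ⊆ Set.Ico (0 : ℝ) 1 := fun x hx =>
    ⟨ha.1.trans hx.1, hx.2.trans_lt (max_lt hb.2 hr₀.2)⟩
  obtain ⟨y, hy, hmax⟩ := isCompact_Icc.exists_isMaxOn
    (⟨r₀, har₀, le_max_right _ _⟩ : (Set.Icc a (max b r₀)).Nonempty) (hρ.mono hsub)
  refine ⟨y, hsub hy, hy.1, fun r hr har => ?_⟩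
  rcases le_total r (max b r₀) with h | h
  · exact hmax ⟨har, h⟩
  · exact (hbound r hr ((le_max_left _ _).trans h)).trans (hmax ⟨har₀, le_max_right _ _⟩)

/-- The quotients of the monomial means by an unbounded log-convex weight, normalized to have
maximum `1`, form a peaked sequence. -/
theorem exists_isPeakedSequence (hφ : IsLogConvexWeight φ) (hW : IsLogConvexWeight W)
    (hd : 1 ≤ d) (hq : 0 < q)
    (hunb : ∀ B : ℝ, ∃ b ∈ Set.Ico (0 : ℝ) 1, B ≤ W b) :
    ∃ (c : ℕ → ℝ) (y : ℕ → ℝ), (∀ n, 0 < c n) ∧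
      IsPeakedSequence q (fun n r => c n * (monomialMean φ d q n r / W r)) y := by
  have hw := hφ.toIsWeight
  have hWw := hW.toIsWeight
  obtain ⟨ρ, hρ⟩ : ∃ ρ : ℕ → ℝ → ℝ, ∀ n r, ρ n r = monomialMean φ d q n r / W r :=
    ⟨_, fun _ _ => rfl⟩
  have m0 : (0 : ℝ) ∈ Set.Ico (0 : ℝ) 1 := ⟨le_rfl, zero_lt_one⟩
  have ρnonneg : ∀ n, ∀ r ∈ Set.Ico (0 : ℝ) 1, 0 ≤ ρ n r := fun n r hr => by
    rw [hρ]; exact div_nonneg (hw.monomialMean_nonneg hd hq hr) (hW.pos r hr).le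
  have ρpos : ∀ n, ∀ r ∈ Set.Ico (0 : ℝ) 1, 0 < r ∨ n = 0 → 0 < ρ n r := fun n r hr h => by
    rw [hρ]; exact div_pos (hw.monomialMean_pos hd hq hr h) (hW.pos r hr)
  have ρzero : ∀ n, 0 < n → ρ n 0 = 0 := fun n hn => by
    rw [hρ, monomialMean_zero_right φ d hq hn, zero_div]
  have ρcont : ∀ n, ContinuousOn (ρ n) (Set.Ico 0 1) := fun n => by
    have : ρ n = fun r => monomialMean φ d q n r / W r := funext (hρ n)
    rw [this]
    exact (hw.continuousOn_monomialMean hd hq n).div hW.continuousOn fun x hx => (hW.pos x hx).ne'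
  have ρcross : ∀ m n, m ≤ n → ∀ a ∈ Set.Ico (0 : ℝ) 1, ∀ b ∈ Set.Ico (0 : ℝ) 1, a ≤ b →
      ρ n a * ρ m b ≤ ρ n b * ρ m a := fun m n hmn a ha b hb hab => by
    simp only [hρ]
    rw [div_mul_div_comm, div_mul_div_comm, mul_comm (W b)]
    exact div_le_div_of_nonneg_right (hw.monomialMean_cross hd hq hmn ha hb hab)
      (mul_nonneg (hW.pos a ha).le (hW.pos b hb).le)
  have ρlim : ∀ n, ∀ ε : ℝ, 0 < ε →
      ∃ b ∈ Set.Ico (0 : ℝ) 1, ∀ r ∈ Set.Ico (0 : ℝ) 1, b ≤ r → ρ n r ≤ ε := by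
    intro n ε hε
    have pφ0 := hφ.pos 0 m0
    have hp := monomialMean_exponent_nonneg hd hq n
    obtain ⟨M, hM⟩ : ∃ M, M = 1 / ((n * q + (2 * d - 1) + 1) * φ 0) := ⟨_, rfl⟩
    have hM0 : 0 < M := by rw [hM]; positivity
    obtain ⟨b, hb, hBb⟩ := hunb (M / ε)
    refine ⟨b, hb, fun r hr hbr => ?_⟩
    have h1 : monomialMean φ d q n r ≤ M := by
      have := hw.monomialMean_le (n := n) hd hq hr
      rw [← hM] at this
      exact this.trans (mul_le_of_le_one_left hM0.le
        (Real.rpow_le_one hr.1 hr.2.le (by positivity)))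
    have h2 : M / ε ≤ W r := hBb.trans (hW.monotoneOn hb hr hbr)
    rw [hρ, div_le_iff₀ (hW.pos r hr)]
    rw [div_le_iff₀ hε] at h2
    linarith
  have hstep : ∀ n, ∀ a ∈ Set.Ico (0 : ℝ) 1, ∃ y ∈ Set.Ico (0 : ℝ) 1, a ≤ y ∧
      ∀ r ∈ Set.Ico (0 : ℝ) 1, a ≤ r → ρ n r ≤ ρ n y := fun n a ha =>
    exists_isMaxOn_Ico (ρcont n) (ρlim n) ha ⟨(a + 1) / 2, ⟨by linarith [ha.1], by linarith [ha.2]⟩,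
      by linarith [ha.2], ρpos n _ ⟨by linarith [ha.1], by linarith [ha.2]⟩
        (Or.inl (by linarith [ha.1]))⟩
  choose! pick hpick_mem hpick_ge hpick_max using hstep
  -- Maximizing only over `[y k, 1)` makes the peaks monotone by construction; that they are global
  -- maxima is `ρmax`.
  let y : ℕ → ℝ := fun n => Nat.rec 0 (fun k yk => pick (k + 1) yk) n
  have hy0 : y 0 = 0 := rfl
  have hys : ∀ k, y (k + 1) = pick (k + 1) (y k) := fun k => rfl
  have hymem : ∀ k, y k ∈ Set.Ico (0 : ℝ) 1 := by
    intro k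
    induction k with
    | zero => exact m0
    | succ k ih => rw [hys]; exact hpick_mem _ _ ih
  have hymono : Monotone y := monotone_nat_of_le_succ fun k => by
    rw [hys]; exact hpick_ge _ _ (hymem k)
  have hy1 : 0 < y 1 := by
    refine lt_of_le_of_ne (hymem 1).1 fun h => ?_
    have hh : (1 / 2 : ℝ) ∈ Set.Ico (0 : ℝ) 1 := ⟨by norm_num, by norm_num⟩
    have h1 := hpick_max 1 0 m0 (1 / 2) hh (by norm_num)
    have h2 := ρpos 1 (1 / 2) hh (Or.inl (by norm_num))
    rw [show pick 1 0 = y 1 from rfl, ← h, ρzero 1 one_pos] at h1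
    linarith
  have hypos : ∀ n, 0 < ρ n (y n) := by
    intro n
    rcases Nat.eq_zero_or_pos n with rfl | hn
    · exact ρpos 0 _ (hymem 0) (Or.inr rfl)
    · exact ρpos n _ (hymem n) (Or.inl (hy1.trans_le (hymono hn)))
  have ρmax : ∀ n, ∀ r ∈ Set.Ico (0 : ℝ) 1, ρ n r ≤ ρ n (y n) := by
    intro n
    induction n with
    | zero =>
      intro r hr
      simp only [hρ, hy0]
      have hJ := hw.dilatedMoment_anti (monomialMean_exponent_nonneg hd hq 0) m0 hr hr.1
      simp only [monomialMean, Nat.cast_zero, zero_mul, Real.rpow_zero, one_mul] at hJ ⊢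
      refine div_le_div₀ ?_ hJ (hW.pos _ m0) (hW.monotoneOn m0 hr hr.1)
      have := (hw.dilatedMoment_pos (monomialMean_exponent_nonneg hd hq 0) m0).le
      simpa using this
    | succ n ih =>
      intro r hr
      rcases le_total (y n) r with h | h
      · rw [hys]; exact hpick_max _ _ (hymem n) r hr h
      -- To the left of `y n` both `ρ (n + 1) / ρ n` and `ρ n` are at most their values at `y n`.
      · have h1 := ρcross n (n + 1) (Nat.le_succ n) r hr _ (hymem n) h
        have h2 : ρ (n + 1) (y n) ≤ ρ (n + 1) (y (n + 1)) := by
          rw [hys]; exact hpick_max _ _ (hymem n) _ (hymem n) le_rfl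
        refine le_trans ?_ h2
        have h3 := mul_le_mul_of_nonneg_left (ih r hr) (ρnonneg (n + 1) _ (hymem n))
        exact le_of_mul_le_mul_right (h1.trans h3) (hypos n)
  have hdecay : ∀ a ∈ Set.Ico (0 : ℝ) 1, ∃ C κ : ℝ, 0 ≤ κ ∧ κ < 1 ∧
      ∀ n, ∀ r ∈ Set.Ico (0 : ℝ) 1, r ≤ a → ρ n r / ρ n (y n) ≤ C * κ ^ n := by
    intro a ha
    obtain ⟨b, hab, hb1⟩ := exists_between ha.2
    have hb0 := ha.1.trans_lt hab
    have hb : b ∈ Set.Ico (0 : ℝ) 1 := ⟨hb0.le, hb1⟩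
    refine ⟨φ b * W b / (φ 0 * W 0), (a / b) ^ q, Real.rpow_nonneg (div_nonneg ha.1 hb0.le) _,
      Real.rpow_lt_one (div_nonneg ha.1 hb0.le) ((div_lt_one hb0).2 hab) hq, fun n r hr hra => ?_⟩
    rw [div_le_iff₀ (hypos n)]
    have h1 := hw.monomialMean_div_le hWw hd hq n ha hb hab hr.1 hra
    rw [← hρ, ← hρ] at h1
    refine h1.trans (mul_le_mul_of_nonneg_left (ρmax n b hb) ?_)
    have := hφ.pos b hb; have := hφ.pos 0 m0; have := hW.pos b hb; have := hW.pos 0 m0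
    have : 0 ≤ a / b := div_nonneg ha.1 hb0.le
    positivity
  have hgeom : ∀ C κ : ℝ, 0 ≤ κ → κ < 1 →
      Filter.Tendsto (fun n : ℕ => C * κ ^ n) Filter.atTop (nhds 0) := fun C κ h0 h1 => by
    simpa using (tendsto_pow_atTop_nhds_zero_of_lt_one h0 h1).const_mul C
  have hytend : Filter.Tendsto y Filter.atTop (nhds 1) := by
    refine tendsto_order.2 ⟨fun a ha => ?_, fun a ha => Filter.Eventually.of_forall fun n =>
      (hymem n).2.trans ha⟩
    have ha' : max a 0 ∈ Set.Ico (0 : ℝ) 1 := ⟨le_max_right _ _, max_lt ha one_pos⟩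
    obtain ⟨C, κ, hκ0, hκ1, hC⟩ := hdecay _ ha'
    filter_upwards [(hgeom C κ hκ0 hκ1).eventually (gt_mem_nhds one_pos)] with n hn
    -- A peak staying in `[0, a]` would give the value `1` to a quotient bounded by `C * κ ^ n`.
    by_contra! hcon
    have := hC n _ (hymem n) (hcon.trans (le_max_left _ _))
    rw [div_self (hypos n).ne'] at this
    linarith
  refine ⟨fun n => (ρ n (y n))⁻¹, y, fun n => inv_pos.2 (hypos n), ?_⟩
  have hτ : (fun n r => (ρ n (y n))⁻¹ * (monomialMean φ d q n r / W r))
      = fun n r => ρ n r / ρ n (y n) := by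
    funext n r
    rw [← hρ, div_eq_inv_mul]
  rw [hτ]
  exact
  { nonneg := fun n r hr => div_nonneg (ρnonneg n r hr) (hypos n).le
    le_one := fun n r hr => (div_le_one (hypos n)).2 (ρmax n r hr)
    peak := fun n => div_self (hypos n).ne'
    mem := hymem
    mono := hymono
    zero := hy0
    one_pos := hy1
    pos := div_pos (ρpos 0 _ (hymem 1) (Or.inr rfl)) (hypos 0)
    eq_zero := fun n hn => by rw [ρzero n hn, zero_div]
    cross := fun m n hmn a ha b hb hab => by
      rw [div_mul_div_comm, div_mul_div_comm]
      exact div_le_div_of_nonneg_right (ρcross m n hmn a ha b hb hab)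
        (mul_pos (hypos n) (hypos m)).le
    growth := fun n a ha b hb hab => by
      have h := hφ.monomialMean_growth hd hq n ha hb hab
      have hk : 0 ≤ 1 / (W a * W b * (ρ (n + 1) (y (n + 1)) * ρ n (y n))) :=
        one_div_nonneg.2 (mul_pos (mul_pos (hW.pos a ha) (hW.pos b hb))
          (mul_pos (hypos _) (hypos _))).le
      have e : ∀ A B : ℝ, A / W a / ρ n (y n) * (B / W b / ρ (n + 1) (y (n + 1)))
          = A * B * (1 / (W a * W b * (ρ (n + 1) (y (n + 1)) * ρ n (y n)))) := fun A B => by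
        simp only [div_eq_mul_inv, mul_inv, one_mul]
        ring
      rw [mul_comm (ρ (n + 1) b / _), hρ n a, hρ (n + 1) b, e]
      have e' : ∀ A B : ℝ, B / W a / ρ (n + 1) (y (n + 1)) * (A / W b / ρ n (y n))
          = A * B * (1 / (W a * W b * (ρ (n + 1) (y (n + 1)) * ρ n (y n)))) := fun A B => by
        simp only [div_eq_mul_inv, mul_inv, one_mul]
        ring
      rw [hρ (n + 1) a, hρ n b, e', ← mul_assoc, ← mul_assoc, ← mul_assoc (b ^ q),
        ← mul_assoc (b ^ q)]
      refine mul_le_mul_of_nonneg_right ?_ hk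
      linarith
    quasiconcave := fun n a ha b hb r har hrb ε h1 h2 => by
      have h := hφ.monomialMean_div_quasiconcave hW hd hq n ha hb har hrb
      rw [← hρ, ← hρ, ← hρ] at h
      rw [le_div_iff₀ (hypos n)] at h1 h2 ⊢
      exact (le_min h1 h2).trans h
    tendsto_peak := hytend
    tendsto_zero := fun r hr => by
      obtain ⟨C, κ, hκ0, hκ1, hC⟩ := hdecay r hr
      exact squeeze_zero (fun n => div_nonneg (ρnonneg n r hr) (hypos n).le)
        (fun n => hC n r hr le_rfl) (hgeom C κ hκ0 hκ1)
    tendsto_boundary := fun n => by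
      refine tendsto_order.2 ⟨fun a ha => Filter.Eventually.of_forall fun m =>
        ha.trans_le (div_nonneg (ρnonneg n _ (hymem m)) (hypos n).le), fun a ha => ?_⟩
      obtain ⟨b, hb, hbound⟩ := ρlim n (a / 2 * ρ n (y n)) (mul_pos (by linarith) (hypos n))
      filter_upwards [hytend.eventually (eventually_gt_nhds hb.2)] with m hm
      rw [div_lt_iff₀ (hypos n)]
      have := hbound _ (hymem m) hm.le
      nlinarith [hypos n] }

end MonomialMean

/-! ### A subadditive gauge for `L^q`, for all `q > 0` -/

open scoped ENNReal in
/-- The power `min 1 (1 / q)` of `∫ h ^ q`: a subadditive functional for every `q > 0`. -/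
noncomputable def lpGauge {Ω : Type*} [MeasurableSpace Ω] (q : ℝ) (μ : Measure Ω)
    (h : Ω → ℝ≥0∞) : ℝ≥0∞ :=
  (∫⁻ x, h x ^ q ∂μ) ^ (min 1 (1 / q))

section LpGauge

open scoped ENNReal

variable {Ω : Type*} [MeasurableSpace Ω] {q : ℝ} {μ : Measure Ω} {f g : Ω → ℝ≥0∞}

theorem min_one_one_div_pos (hq : 0 < q) : 0 < min 1 (1 / q) := lt_min one_pos (by positivity)

theorem lpGauge_mono (hq : 0 < q) (h : ∀ᵐ x ∂μ, f x ≤ g x) : lpGauge q μ f ≤ lpGauge q μ g :=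
  ENNReal.rpow_le_rpow
    (lintegral_mono_ae (h.mono fun _ hx => ENNReal.rpow_le_rpow hx hq.le))
    (min_one_one_div_pos hq).le

theorem lpGauge_zero (hq : 0 < q) : lpGauge q μ (fun _ => 0) = 0 := by
  simp [lpGauge, hq]

/-- For `q ≤ 1` the exponent is `1` and `t ^ q` is subadditive; for `q ≥ 1` this is Minkowski's
inequality. -/
theorem lpGauge_add_le (hq : 0 < q) (hf : AEMeasurable f μ) (hg : AEMeasurable g μ) :
    lpGauge q μ (fun x => f x + g x) ≤ lpGauge q μ f + lpGauge q μ g := by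
  unfold lpGauge
  rcases le_total q 1 with h | h
  · rw [min_eq_left (by rw [le_div_iff₀ hq]; linarith)]
    simp only [ENNReal.rpow_one]
    rw [← lintegral_add_left' (hf.pow_const q)]
    exact lintegral_mono fun x => ENNReal.rpow_add_le_add_rpow _ _ hq.le h
  · rw [min_eq_right (by rw [div_le_iff₀ hq]; linarith)]
    exact ENNReal.lintegral_Lp_add_le hf hg h

theorem lpGauge_finset_sum_le (hq : 0 < q) {f : ℕ → Ω → ℝ≥0∞} (hf : ∀ j, AEMeasurable (f j) μ)
    (n : ℕ) : lpGauge q μ (fun x => ∑ j ∈ Finset.range n, f j x)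
      ≤ ∑ j ∈ Finset.range n, lpGauge q μ (f j) := by
  induction n with
  | zero => simp [lpGauge_zero hq]
  | succ n ih =>
    simp only [Finset.sum_range_succ]
    exact (lpGauge_add_le hq (Finset.aemeasurable_fun_sum _ fun j _ => hf j) (hf n)).trans
      (add_le_add ih le_rfl)

/-- Monotone convergence along the partial sums. -/
theorem lpGauge_tsum_le (hq : 0 < q) {f : ℕ → Ω → ℝ≥0∞} (hf : ∀ j, AEMeasurable (f j) μ) :
    lpGauge q μ (fun x => ∑' j, f j x) ≤ ∑' j, lpGauge q μ (f j) := by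
  have hs := min_one_one_div_pos hq
  have hpart := fun n => (lpGauge_finset_sum_le hq hf n).trans (ENNReal.sum_le_tsum _)
  unfold lpGauge at hpart ⊢
  set B := ∑' j, (∫⁻ x, f j x ^ q ∂μ) ^ (min 1 (1 / q))
  have e : ∀ x, (∑' j, f j x) ^ q = ⨆ n, (∑ j ∈ Finset.range n, f j x) ^ q := fun x => by
    rw [ENNReal.tsum_eq_iSup_nat]
    exact (ENNReal.orderIsoRpow q hq).map_iSup _
  simp only [e]
  rw [lintegral_iSup' (fun n => (Finset.aemeasurable_fun_sum _ fun j _ => hf j).pow_const q)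
    (Filter.Eventually.of_forall fun x m n hmn => ENNReal.rpow_le_rpow
      (Finset.sum_le_sum_of_subset (Finset.range_mono hmn)) hq.le),
    ← ENNReal.le_rpow_inv_iff hs]
  refine iSup_le fun n => ?_
  rw [ENNReal.le_rpow_inv_iff hs]
  exact hpart n

/-- From `2 A = (A + B) + (A - B)`. The gauge has degree `q` when `q < 1`, so the factor `2` on the
left is dropped by `|A| ≤ |2 A|` rather than divided out. -/
theorem lpGauge_le_two_mul_of_sub {A B : Ω → ℂ} (hq : 0 < q) (hA : AEMeasurable A μ)
    (hB : AEMeasurable B μ)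
    (h : lpGauge q μ (fun x => ‖A x - B x‖ₑ) = lpGauge q μ (fun x => ‖A x + B x‖ₑ)) :
    lpGauge q μ (fun x => ‖A x‖ₑ) ≤ 2 * lpGauge q μ (fun x => ‖A x + B x‖ₑ) := by
  rw [two_mul]
  nth_rw 2 [← h]
  refine le_trans (lpGauge_mono hq ?_) (lpGauge_add_le hq (hA.add hB).enorm (hA.sub hB).enorm)
  refine Filter.Eventually.of_forall fun x => ?_
  have h1 : ‖A x‖ₑ ≤ ‖(A x + B x) + (A x - B x)‖ₑ := by
    rw [show (A x + B x) + (A x - B x) = 2 * A x by ring, enorm_mul]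
    refine le_mul_of_one_le_left (by simp) ?_
    rw [← ofReal_norm]
    simp
  exact h1.trans (enorm_add_le _ _)

/-- A sequence decaying geometrically away from two consecutive indices. -/
theorem tsum_le_of_two_sided_decay {u : ℕ → ℝ} (hu : ∀ j, 0 ≤ u j) {k : ℕ}
    (h1 : ∀ j, k + 1 ≤ j → u (j + 1) ≤ 1 / 16 * u j)
    (h2 : ∀ j, j < k → u j ≤ 1 / 16 * u (j + 1)) :
    Summable u ∧ ∑' j, u j ≤ 16 / 15 * (u k + u (k + 1)) := by
  have ht : ∀ i, u (i + (k + 1)) ≤ u (k + 1) * (1 / 16) ^ i := by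
    intro i
    induction i with
    | zero => simp
    | succ i ih =>
      have := h1 (i + (k + 1)) (by omega)
      rw [show i + 1 + (k + 1) = i + (k + 1) + 1 by ring, pow_succ]
      linarith
  have hg : Summable fun i : ℕ => u (k + 1) * (1 / 16 : ℝ) ^ i :=
    (summable_geometric_of_lt_one (by norm_num) (by norm_num)).mul_left _
  have hst : Summable fun i => u (i + (k + 1)) := Summable.of_nonneg_of_le (fun i => hu _) ht hg
  have hs : Summable u := (summable_nat_add_iff (k + 1)).1 hst
  -- The constant reproduces itself: `1 + (1 / 16) * (16 / 15) = 16 / 15`.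
  have hhead : ∀ l, l ≤ k → ∑ j ∈ Finset.range (l + 1), u j ≤ 16 / 15 * u l := by
    intro l hl
    induction l with
    | zero => simp; linarith [hu 0]
    | succ l ih =>
      rw [Finset.sum_range_succ]
      have := ih (by omega)
      have := h2 l (by omega)
      linarith
  refine ⟨hs, ?_⟩
  rw [← hs.sum_add_tsum_nat_add (k + 1)]
  have htail := hst.tsum_le_tsum ht hg
  rw [tsum_mul_left, tsum_geometric_of_lt_one (by norm_num) (by norm_num)] at htail
  have := hhead k le_rfl
  norm_num at htail
  linarith

/-- If two consecutive terms of a series dominate the others geometrically, and do not cancel,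
then the size of the sum is comparable with the larger one of the sizes of these two terms. -/
theorem lpGauge_dominated_sum {A : ℕ → Ω → ℂ} {F : Ω → ℂ} {u : ℕ → ℝ} {k : ℕ} (hq : 0 < q)
    (hA : ∀ j, AEMeasurable (A j) μ) (hF : AEMeasurable F μ)
    (hsum : ∀ᵐ x ∂μ, HasSum (fun j => A j x) (F x)) (hu : ∀ j, 0 ≤ u j)
    (hAu : ∀ j, lpGauge q μ (fun x => ‖A j x‖ₑ) = ENNReal.ofReal (u j))
    (h1 : ∀ j, k + 1 ≤ j → u (j + 1) ≤ 1 / 16 * u j)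
    (h2 : ∀ j, j < k → u j ≤ 1 / 16 * u (j + 1))
    (hcancel : lpGauge q μ (fun x => ‖A k x - A (k + 1) x‖ₑ)
      = lpGauge q μ (fun x => ‖A k x + A (k + 1) x‖ₑ)) :
    lpGauge q μ (fun x => ‖F x‖ₑ) ≤ ENNReal.ofReal (2 * (u k + u (k + 1))) ∧
      ENNReal.ofReal (u k + u (k + 1)) ≤ 6 * lpGauge q μ (fun x => ‖F x‖ₑ) := by
  classical
  obtain ⟨hs, hsu⟩ := tsum_le_of_two_sided_decay hu h1 h2
  have hupper : lpGauge q μ (fun x => ‖F x‖ₑ) ≤ ENNReal.ofReal (2 * (u k + u (k + 1))) := by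
    calc lpGauge q μ (fun x => ‖F x‖ₑ) ≤ lpGauge q μ (fun x => ∑' j, ‖A j x‖ₑ) := by
          refine lpGauge_mono hq (hsum.mono fun x hx => ?_)
          rw [← hx.tsum_eq]
          exact enorm_tsum_le_tsum_enorm
      _ ≤ ∑' j, lpGauge q μ (fun x => ‖A j x‖ₑ) := lpGauge_tsum_le hq fun j => (hA j).enorm
      _ = ENNReal.ofReal (∑' j, u j) := by
          simp only [hAu]
          exact (ENNReal.ofReal_tsum_of_nonneg hu hs).symm
      _ ≤ _ := ENNReal.ofReal_le_ofReal (by linarith [hu k, hu (k + 1)])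
  refine ⟨hupper, ?_⟩
  -- The series with the two main terms removed has total size at most `(16 / 15 - 1) * (u k + u (k
  -- + 1))`.
  let S : Finset ℕ := {k, k + 1}
  let B : ℕ → Ω → ℂ := fun j x => A j x - if j ∈ S then A j x else 0
  let v : ℕ → ℝ := fun j => u j - if j ∈ S then u j else 0
  have hv : ∀ j, 0 ≤ v j := fun j => by
    by_cases hj : j ∈ S <;> simp [v, hj, hu j]
  have hsub : HasSum (fun j => if j ∈ S then u j else 0) (u k + u (k + 1)) := by
    have : HasSum (fun j => if j ∈ S then u j else 0) (∑ j ∈ S, if j ∈ S then u j else 0) :=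
      hasSum_sum_of_ne_finset_zero fun b hb => by simp [hb]
    simpa [S] using this
  have hvs : HasSum v (∑' j, u j - (u k + u (k + 1))) := hs.hasSum.sub hsub
  have hBv : ∀ j, lpGauge q μ (fun x => ‖B j x‖ₑ) = ENNReal.ofReal (v j) := fun j => by
    by_cases hj : j ∈ S
    · simp [B, v, hj, lpGauge_zero hq]
    · simp [B, v, hj, hAu j]
  have hBm : ∀ j, AEMeasurable (B j) μ := fun j => by
    by_cases hj : j ∈ S
    · simp [B, hj]
    · simpa [B, hj] using hA j
  have hrest : lpGauge q μ (fun x => ‖A k x + A (k + 1) x - F x‖ₑ)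
      ≤ ENNReal.ofReal (1 / 15 * (u k + u (k + 1))) := by
    calc _ ≤ lpGauge q μ (fun x => ∑' j, ‖B j x‖ₑ) := by
          refine lpGauge_mono hq (hsum.mono fun x hx => ?_)
          have h3 : HasSum (fun j => if j ∈ S then A j x else 0) (A k x + A (k + 1) x) := by
            have : HasSum (fun j => if j ∈ S then A j x else 0)
                (∑ j ∈ S, if j ∈ S then A j x else 0) :=
              hasSum_sum_of_ne_finset_zero fun b hb => by simp [hb]
            simpa [S] using this
          rw [← enorm_neg, neg_sub, ← (hx.sub h3).tsum_eq]
          exact enorm_tsum_le_tsum_enorm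
      _ ≤ ∑' j, lpGauge q μ (fun x => ‖B j x‖ₑ) := lpGauge_tsum_le hq fun j => (hBm j).enorm
      _ = ENNReal.ofReal (∑' j, v j) := by
          simp only [hBv]
          exact (ENNReal.ofReal_tsum_of_nonneg hv hvs.summable).symm
      _ ≤ _ := by
          rw [hvs.tsum_eq]
          exact ENNReal.ofReal_le_ofReal (by linarith)
  have hAB : lpGauge q μ (fun x => ‖A k x + A (k + 1) x‖ₑ)
      ≤ lpGauge q μ (fun x => ‖F x‖ₑ) + ENNReal.ofReal (1 / 15 * (u k + u (k + 1))) := by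
    refine le_trans (lpGauge_mono hq (g := fun x => ‖F x‖ₑ + ‖A k x + A (k + 1) x - F x‖ₑ)
      (Filter.Eventually.of_forall fun x => ?_))
      ((lpGauge_add_le hq hF.enorm (((hA k).add (hA (k + 1))).sub hF).enorm).trans
        (add_le_add le_rfl hrest))
    calc ‖A k x + A (k + 1) x‖ₑ = ‖F x + (A k x + A (k + 1) x - F x)‖ₑ := by congr 1; ring
      _ ≤ _ := enorm_add_le _ _
  have ha := lpGauge_le_two_mul_of_sub hq (hA k) (hA (k + 1)) hcancel
  have hb := lpGauge_le_two_mul_of_sub hq (hA (k + 1)) (hA k) (by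
    simp only [add_comm (A (k + 1) _)]
    rw [← hcancel]
    congr 1
    funext x
    rw [← enorm_neg, neg_sub])
  simp only [add_comm (A (k + 1) _)] at hb
  rw [hAu] at ha hb
  have hNtop : lpGauge q μ (fun x => ‖F x‖ₑ) ≠ ∞ := ne_top_of_le_ne_top ENNReal.ofReal_ne_top hupper
  have hMtop := ne_top_of_le_ne_top (ENNReal.add_ne_top.2 ⟨hNtop, ENNReal.ofReal_ne_top⟩) hAB
  obtain ⟨N, hN⟩ : ∃ N, lpGauge q μ (fun x => ‖F x‖ₑ) = N := ⟨_, rfl⟩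
  obtain ⟨M, hM⟩ : ∃ M, lpGauge q μ (fun x => ‖A k x + A (k + 1) x‖ₑ) = M := ⟨_, rfl⟩
  rw [hN] at hAB hNtop ⊢
  rw [hM] at hAB ha hb hMtop
  have hS : 0 ≤ u k + u (k + 1) := add_nonneg (hu _) (hu _)
  have ha' : u k ≤ 2 * M.toReal := by
    have := (ENNReal.ofReal_le_iff_le_toReal (ENNReal.mul_ne_top (by simp) hMtop)).1 ha
    simpa using this
  have hb' : u (k + 1) ≤ 2 * M.toReal := by
    have := (ENNReal.ofReal_le_iff_le_toReal (ENNReal.mul_ne_top (by simp) hMtop)).1 hb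
    simpa using this
  have hAB' : M.toReal ≤ N.toReal + 1 / 15 * (u k + u (k + 1)) := by
    have := ENNReal.toReal_mono (ENNReal.add_ne_top.2 ⟨hNtop, ENNReal.ofReal_ne_top⟩) hAB
    rwa [ENNReal.toReal_add hNtop ENNReal.ofReal_ne_top,
      ENNReal.toReal_ofReal (by positivity)] at this
  -- With `S = u k + u (k + 1)`: `S ≤ 4 M` and `M ≤ N + S / 15` give `S ≤ (60 / 11) N`, below `6 N`.
  rw [ENNReal.ofReal_le_iff_le_toReal (ENNReal.mul_ne_top (by simp) hNtop)]
  rw [ENNReal.toReal_mul]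
  norm_num
  linarith [hu k, hu (k + 1)]

end LpGauge

/-! ### Polar coordinates -/

section Polar

variable {E : Type*} [NormedAddCommGroup E] [NormedSpace ℝ E] [FiniteDimensional ℝ E]
  [Nontrivial E] [MeasurableSpace E] [BorelSpace E] (μ : Measure E) [μ.IsAddHaarMeasure]

/-- Polar coordinates for the product of a function of the direction and one of the norm. -/
theorem integral_direction_mul_norm (G : E → ℝ) (h : ℝ → ℝ) :
    ∫ x, G (‖x‖⁻¹ • x) * h ‖x‖ ∂μ = (∫ ζ, G (ζ : Metric.sphere (0 : E) 1) ∂μ.toSphere) *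
      ∫ t in Set.Ioi (0 : ℝ), t ^ (Module.finrank ℝ E - 1) * h t :=
  calc ∫ x, G (‖x‖⁻¹ • x) * h ‖x‖ ∂μ
      = ∫ x : ({(0)}ᶜ : Set E), G (‖x.1‖⁻¹ • x.1) * h ‖x.1‖ ∂(μ.comap (↑)) := by
        rw [integral_subtype_comap (measurableSet_singleton _).compl
          fun x => G (‖x‖⁻¹ • x) * h ‖x‖, restrict_compl_singleton]
    _ = ∫ x : Metric.sphere (0 : E) 1 × Set.Ioi (0 : ℝ), G x.1 * h x.2
          ∂μ.toSphere.prod (.volumeIoiPow (Module.finrank ℝ E - 1)) := by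
        simpa using μ.measurePreserving_homeomorphUnitSphereProd.integral_comp
          (Homeomorph.measurableEmbedding _)
          (fun x : Metric.sphere (0 : E) 1 × Set.Ioi (0 : ℝ) => G x.1 * h x.2)
    _ = (∫ ζ, G (ζ : Metric.sphere (0 : E) 1) ∂μ.toSphere) *
          ∫ t : Set.Ioi (0 : ℝ), h t ∂.volumeIoiPow (Module.finrank ℝ E - 1) :=
        integral_prod_mul (fun ζ : Metric.sphere (0 : E) 1 => G ζ) fun t : Set.Ioi (0 : ℝ) => h t
    _ = _ := by
        congr 1
        simp only [Measure.volumeIoiPow, ENNReal.ofReal]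
        rw [integral_withDensity_eq_integral_smul (by fun_prop),
          integral_subtype_comap measurableSet_Ioi fun t : ℝ =>
            Real.toNNReal (t ^ (Module.finrank ℝ E - 1)) • h t]
        refine setIntegral_congr_fun measurableSet_Ioi fun t ht => ?_
        have : (0 : ℝ) ≤ t ^ (Module.finrank ℝ E - 1) := pow_nonneg (le_of_lt ht) _
        simp [NNReal.smul_def, this]

end Polar

theorem finrank_real_euclideanSpace_complex (d : ℕ) :
    Module.finrank ℝ (EuclideanSpace ℂ (Fin d)) = 2 * d := by
  rw [finrank_real_of_complex]; simp

/-- The integral of `|ζ i| ^ c` over the unit sphere. -/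
noncomputable def sphereMoment {d : ℕ} (i : Fin d) (c : ℝ) : ℝ :=
  ∫ ζ : Metric.sphere (0 : EuclideanSpace ℂ (Fin d)) 1, ‖ζ.1 i‖ ^ c
    ∂(volume : Measure (EuclideanSpace ℂ (Fin d))).toSphere

theorem sphereMoment_pos {d : ℕ} (i : Fin d) {c : ℝ} (hc : 0 ≤ c) : 0 < sphereMoment i c := by
  have hcont : Continuous fun ζ : Metric.sphere (0 : EuclideanSpace ℂ (Fin d)) 1 => ‖ζ.1 i‖ ^ c :=
    (Continuous.norm (by fun_prop)).rpow_const fun _ => Or.inr hc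
  refine hcont.integral_pos_of_hasCompactSupport_nonneg_nonzero
    (HasCompactSupport.of_compactSpace _) (fun ζ => Real.rpow_nonneg (norm_nonneg _) _)
    (x := ⟨EuclideanSpace.single i 1, by simp⟩) ?_
  simp

/-- Polar coordinates for the power of the modulus of a coordinate times a radial function. -/
theorem setIntegral_ball_coord_rpow_mul {d : ℕ} (i : Fin d) {c r : ℝ} (hr : 0 < r)
    (φ : ℝ → ℝ) :
    ∫ z in Metric.ball (0 : EuclideanSpace ℂ (Fin d)) r, ‖z i‖ ^ c * (1 / φ ‖z‖)
      = sphereMoment i c * radialMoment φ (c + (2 * d - 1)) r := by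
  have hd : 1 ≤ d := Nat.one_le_of_lt (Fin.pos i)
  have : Nonempty (Fin d) := ⟨i⟩
  have h := integral_direction_mul_norm (volume : Measure (EuclideanSpace ℂ (Fin d)))
    (fun z => ‖z i‖ ^ c) ((Set.Iio r).indicator fun t => t ^ c * (1 / φ t))
  rw [finrank_real_euclideanSpace_complex] at h
  rw [← integral_indicator measurableSet_ball]
  -- Homogeneity of degree `c` separates direction and norm away from the origin, a null set.
  calc _ = ∫ z : EuclideanSpace ℂ (Fin d), ‖(‖z‖⁻¹ • z) i‖ ^ c *
        (Set.Iio r).indicator (fun t => t ^ c * (1 / φ t)) ‖z‖ := by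
        refine integral_congr_ae ?_
        filter_upwards [compl_mem_ae_iff.2 (measure_singleton (0 : EuclideanSpace ℂ (Fin d)))]
          with z hz
        have hz0 : 0 < ‖z‖ := norm_pos_iff.2 hz
        by_cases hzr : ‖z‖ < r
        · rw [Set.indicator_of_mem (by simpa using hzr), Set.indicator_of_mem (by simpa using hzr),
            PiLp.smul_apply, norm_smul, norm_inv, norm_norm,
            Real.mul_rpow (by positivity) (norm_nonneg _), Real.inv_rpow hz0.le]
          have : 0 < ‖z‖ ^ c := Real.rpow_pos_of_pos hz0 _
          field_simp
        · rw [Set.indicator_of_notMem (by simpa using hzr),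
            Set.indicator_of_notMem (by simpa using hzr), mul_zero]
    _ = _ := by
        rw [h, sphereMoment, radialMoment, intervalIntegral.integral_of_le hr.le]
        congr 1
        have e : ∀ t : ℝ, t ^ (2 * d - 1) * (Set.Iio r).indicator (fun t => t ^ c * (1 / φ t)) t
            = (Set.Iio r).indicator (fun t => t ^ (2 * d - 1) * (t ^ c * (1 / φ t))) t := fun t => by
          by_cases ht : t ∈ Set.Iio r <;> simp [ht]
        simp only [e]
        rw [setIntegral_indicator measurableSet_Iio, Set.Ioi_inter_Iio, integral_Ioc_eq_integral_Ioo]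
        refine setIntegral_congr_fun measurableSet_Ioo fun t ht => ?_
        have : c + (2 * d - 1) = c + ((2 * d - 1 : ℕ) : ℝ) := by
          rw [Nat.cast_sub (by omega)]; push_cast; ring
        rw [this, Real.rpow_add_natCast ht.1.ne']
        ring

/-! ### Weighted integrals over balls and their rotation invariance -/

section WeightedBall

variable {φ : ℝ → ℝ} {d : ℕ} {q r : ℝ} {f : EuclideanSpace ℂ (Fin d) → ℂ}

/-- The integral of `|f| ^ q / φ` over the ball of radius `r`. -/
noncomputable def ballIntegral (d : ℕ) (q : ℝ) (φ : ℝ → ℝ) (f : EuclideanSpace ℂ (Fin d) → ℂ)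
    (r : ℝ) : ℝ :=
  ∫ z in Metric.ball (0 : EuclideanSpace ℂ (Fin d)) r, ‖f z‖ ^ q * (1 / φ ‖z‖)

/-- The measure with density `1 / φ` on the ball of radius `r`. -/
noncomputable def weightedBall (φ : ℝ → ℝ) (d : ℕ) (r : ℝ) :
    Measure (EuclideanSpace ℂ (Fin d)) :=
  (volume.restrict (Metric.ball 0 r)).withDensity fun z => ENNReal.ofReal (1 / φ ‖z‖)

theorem volume_unitBall_toReal_pos (d : ℕ) : 0 < (volume (unitBall d)).toReal :=
  ENNReal.toReal_pos (Metric.isOpen_ball.measure_pos _ (Metric.nonempty_ball.2 one_pos)).ne'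
    measure_ball_lt_top.ne

theorem volumeMean_eq (φ : ℝ → ℝ) (q : ℝ) (f : EuclideanSpace ℂ (Fin d) → ℂ)
    (hr : r ∈ Set.Ioo (0 : ℝ) 1) :
    volumeMean d q (fun t => 1 / φ t) f r = (1 / r ^ (2 * d) *
      ((volume (unitBall d)).toReal⁻¹ * ballIntegral d q φ f r)) ^ (1 / q) := by
  rw [volumeMean, if_neg hr.1.ne', normalizedVolume, Measure.restrict_smul,
    Measure.restrict_restrict measurableSet_ball, unitBall,
    Set.inter_eq_left.2 (Metric.ball_subset_ball hr.2.le), integral_smul_measure,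
    ENNReal.toReal_inv, smul_eq_mul, ballIntegral]

theorem IsWeight.continuousOn_one_div_norm (hφ : IsWeight φ) (d : ℕ) :
    ContinuousOn (fun z : EuclideanSpace ℂ (Fin d) => 1 / φ ‖z‖) (unitBall d) := by
  have hm : ∀ z ∈ unitBall d, ‖z‖ ∈ Set.Ico (0 : ℝ) 1 := fun z hz =>
    ⟨norm_nonneg z, by simpa [unitBall] using hz⟩
  exact continuousOn_const.div (hφ.continuousOn.comp continuous_norm.continuousOn hm)
    fun z hz => (hφ.pos _ (hm z hz)).ne'

theorem IsWeight.continuousOn_integrand (hφ : IsWeight φ) (hq : 0 < q)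
    (hf : ContinuousOn f (unitBall d)) :
    ContinuousOn (fun z => ‖f z‖ ^ q * (1 / φ ‖z‖)) (unitBall d) :=
  (hf.norm.rpow_const fun _ _ => Or.inr hq.le).mul (hφ.continuousOn_one_div_norm d)

theorem IsWeight.integrableOn_integrand (hφ : IsWeight φ) (hq : 0 < q)
    (hf : ContinuousOn f (unitBall d)) (hr : r < 1) :
    IntegrableOn (fun z => ‖f z‖ ^ q * (1 / φ ‖z‖)) (Metric.ball 0 r) :=
  (((hφ.continuousOn_integrand hq hf).mono (Metric.closedBall_subset_ball hr)).integrableOn_compact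
    (isCompact_closedBall _ _)).mono_set Metric.ball_subset_closedBall

theorem IsWeight.aemeasurable_density (hφ : IsWeight φ) (d : ℕ) (hr : r < 1) :
    AEMeasurable (fun z : EuclideanSpace ℂ (Fin d) => ENNReal.ofReal (1 / φ ‖z‖))
      (volume.restrict (Metric.ball 0 r)) :=
  (((hφ.continuousOn_one_div_norm d).mono (Metric.ball_subset_ball hr.le)).aemeasurable
    measurableSet_ball).ennreal_ofReal

theorem aemeasurable_weightedBall (hf : ContinuousOn f (unitBall d)) (hr : r < 1) :
    AEMeasurable f (weightedBall φ d r) :=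
  ((hf.mono (Metric.ball_subset_ball hr.le)).aemeasurable measurableSet_ball).mono_ac
    (withDensity_absolutelyContinuous _ _)

theorem IsWeight.lintegral_weightedBall (hφ : IsWeight φ) (hr : r < 1)
    (hf : ContinuousOn f (unitBall d)) :
    ∫⁻ z, ‖f z‖ₑ ^ q ∂weightedBall φ d r
      = ∫⁻ z in Metric.ball 0 r, ENNReal.ofReal (1 / φ ‖z‖) * ‖f z‖ₑ ^ q := by
  rw [weightedBall, lintegral_withDensity_eq_lintegral_mul₀ (hφ.aemeasurable_density d hr)]
  · rfl
  · exact (((hf.mono (Metric.ball_subset_ball hr.le)).aemeasurable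
      measurableSet_ball).enorm).pow_const q

theorem IsWeight.one_div_norm_pos (hφ : IsWeight φ) {z : EuclideanSpace ℂ (Fin d)}
    (hr : r < 1) (hz : z ∈ Metric.ball 0 r) : 0 < 1 / φ ‖z‖ :=
  one_div_pos.2 (hφ.pos _ ⟨norm_nonneg z, (by simpa using hz : ‖z‖ < r).trans hr⟩)

theorem IsWeight.ballIntegral_nonneg (hφ : IsWeight φ) (hr : r < 1)
    (f : EuclideanSpace ℂ (Fin d) → ℂ) : 0 ≤ ballIntegral d q φ f r :=
  setIntegral_nonneg measurableSet_ball fun _ hz =>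
    mul_nonneg (Real.rpow_nonneg (norm_nonneg _) _) (hφ.one_div_norm_pos hr hz).le

theorem IsWeight.lpGauge_weightedBall (hφ : IsWeight φ) (hq : 0 < q) (hr : r < 1)
    (hf : ContinuousOn f (unitBall d)) :
    lpGauge q (weightedBall φ d r) (fun z => ‖f z‖ₑ)
      = ENNReal.ofReal (ballIntegral d q φ f r ^ (min 1 (1 / q))) := by
  rw [lpGauge, hφ.lintegral_weightedBall hr hf,
    ← ENNReal.ofReal_rpow_of_nonneg (hφ.ballIntegral_nonneg hr f) (min_one_one_div_pos hq).le,
    ballIntegral, ofReal_integral_eq_lintegral_ofReal (hφ.integrableOn_integrand hq hf hr)]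
  · congr 1
    refine setLIntegral_congr_fun measurableSet_ball fun z hz => ?_
    rw [mul_comm, ENNReal.ofReal_mul (Real.rpow_nonneg (norm_nonneg _) _),
      ← ENNReal.ofReal_rpow_of_nonneg (norm_nonneg _) hq.le, ofReal_norm]
  · filter_upwards [ae_restrict_mem measurableSet_ball] with z hz
    exact mul_nonneg (Real.rpow_nonneg (norm_nonneg _) _) (hφ.one_div_norm_pos hr hz).le

/-- Multiplication by a unimodular scalar, as a real linear isometry. -/
noncomputable def circleRotation (d : ℕ) (u : Circle) :
    EuclideanSpace ℂ (Fin d) ≃ₗᵢ[ℝ] EuclideanSpace ℂ (Fin d) where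
  toFun z := (u : ℂ) • z
  invFun z := (u : ℂ)⁻¹ • z
  map_add' := smul_add _
  map_smul' c z := smul_comm _ _ _
  left_inv z := inv_smul_smul₀ (Circle.coe_ne_zero u) z
  right_inv z := smul_inv_smul₀ (Circle.coe_ne_zero u) z
  norm_map' z := by
    change ‖(u : ℂ) • z‖ = ‖z‖
    rw [norm_smul, Circle.norm_coe, one_mul]

theorem circleRotation_apply (u : Circle) (z : EuclideanSpace ℂ (Fin d)) :
    circleRotation d u z = (u : ℂ) • z := rfl

/-- The weighted size is invariant under rotations. -/
theorem IsWeight.lpGauge_rotation (hφ : IsWeight φ) (hr : r < 1)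
    (hf : ContinuousOn f (unitBall d)) (u : Circle) :
    lpGauge q (weightedBall φ d r) (fun z => ‖f ((u : ℂ) • z)‖ₑ)
      = lpGauge q (weightedBall φ d r) (fun z => ‖f z‖ₑ) := by
  have hnorm : ∀ z : EuclideanSpace ℂ (Fin d), ‖(u : ℂ) • z‖ = ‖z‖ := fun z => by
    rw [norm_smul, Circle.norm_coe, one_mul]
  have hfu : ContinuousOn (fun z => f ((u : ℂ) • z)) (unitBall d) :=
    hf.comp (by fun_prop) fun z hz => by simpa [unitBall, hnorm] using hz
  rw [lpGauge, lpGauge, hφ.lintegral_weightedBall hr hf, hφ.lintegral_weightedBall hr hfu]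
  congr 1
  have hmp : MeasurePreserving (circleRotation d u) (volume.restrict (Metric.ball 0 r))
      (volume.restrict (Metric.ball 0 r)) := by
    have h := (circleRotation d u).measurePreserving.restrict_preimage
      (s := Metric.ball 0 r) measurableSet_ball
    have e : (circleRotation d u) ⁻¹' Metric.ball 0 r = Metric.ball 0 r := by
      ext z
      simp
    rwa [e] at h
  have h := hmp.lintegral_comp_emb (circleRotation d u).toHomeomorph.measurableEmbedding
    fun z => ENNReal.ofReal (1 / φ ‖z‖) * ‖f z‖ₑ ^ q
  simpa only [circleRotation_apply, hnorm] using h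

/-- Rotation by such a `u` reverses the relative sign of monomials of degrees `m` and `n`. -/
theorem exists_circle_pow_eq_neg {m n : ℕ} (hmn : m < n) :
    ∃ u : Circle, (u : ℂ) ^ n = -(u : ℂ) ^ m := by
  have h : ((n : ℝ) - m) ≠ 0 := by
    have : (m : ℝ) < n := by exact_mod_cast hmn
    linarith
  obtain ⟨u, hu⟩ : ∃ u : Circle, (u : ℂ) ^ (n - m) = -1 := by
    refine ⟨Circle.exp (Real.pi / (n - m)), ?_⟩
    rw [Circle.coe_exp, ← Complex.exp_nat_mul, ← Complex.exp_pi_mul_I, Nat.cast_sub hmn.le]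
    congr 1
    have : ((n : ℂ) - m) ≠ 0 := by exact_mod_cast h
    push_cast
    field_simp
  refine ⟨u, ?_⟩
  calc (u : ℂ) ^ n = (u : ℂ) ^ (m + (n - m)) := by rw [Nat.add_sub_cancel' hmn.le]
    _ = -(u : ℂ) ^ m := by rw [pow_add, hu]; ring

/-- Monomials of different degrees do not cancel. -/
theorem IsWeight.lpGauge_monomial_sub (hφ : IsWeight φ) (hr : r < 1) (i : Fin d) (a b : ℂ)
    {m n : ℕ} (hmn : m < n) :
    lpGauge q (weightedBall φ d r) (fun z => ‖a * z i ^ m - b * z i ^ n‖ₑ)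
      = lpGauge q (weightedBall φ d r) (fun z => ‖a * z i ^ m + b * z i ^ n‖ₑ) := by
  obtain ⟨u, hu⟩ := exists_circle_pow_eq_neg hmn
  have hc : Continuous fun z : EuclideanSpace ℂ (Fin d) => a * z i ^ m + b * z i ^ n := by
    fun_prop
  rw [← hφ.lpGauge_rotation hr hc.continuousOn u]
  congr 1
  funext z
  rw [PiLp.smul_apply, smul_eq_mul, mul_pow, mul_pow, hu,
    show a * ((u : ℂ) ^ m * z i ^ m) + b * (-(u : ℂ) ^ m * z i ^ n)
      = (u : ℂ) ^ m * (a * z i ^ m - b * z i ^ n) by ring, enorm_mul]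
  have : ‖(u : ℂ) ^ m‖ₑ = 1 := by
    rw [← ofReal_norm, norm_pow, Circle.norm_coe, one_pow, ENNReal.ofReal_one]
  rw [this, one_mul]

theorem ballIntegral_monomial (i : Fin d) (a : ℂ) (n : ℕ) (hr : 0 < r) (φ : ℝ → ℝ) :
    ballIntegral d q φ (fun z => a * z i ^ n) r
      = ‖a‖ ^ q * sphereMoment i (n * q) * (r ^ (2 * d) * monomialMean φ d q n r) := by
  have h := setIntegral_ball_coord_rpow_mul i (c := n * q) hr φ
  have e : ∀ z : EuclideanSpace ℂ (Fin d), ‖a * z i ^ n‖ ^ q * (1 / φ ‖z‖)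
      = ‖a‖ ^ q * (‖z i‖ ^ ((n : ℝ) * q) * (1 / φ ‖z‖)) := fun z => by
    rw [norm_mul, norm_pow, Real.mul_rpow (norm_nonneg _) (by positivity),
      ← Real.rpow_natCast, ← Real.rpow_mul (norm_nonneg _), mul_assoc]
  simp only [ballIntegral, e]
  rw [integral_const_mul, h, monomialMean_eq φ d q n hr]
  have : r ^ (2 * d) ≠ 0 := by positivity
  field_simp

/-- The weighted integrals of monomials do not decay faster than geometrically. -/
theorem IsWeight.exists_le_ballIntegral_monomial (hφ : IsWeight φ) (hq : 0 < q) (i : Fin d)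
    {ρ : ℝ} (hρ : 0 ≤ ρ) (hρr : ρ < r) (hr : r < 1) :
    ∃ m : ℝ, 0 < m ∧ ∀ (a : ℂ) (n : ℕ),
      (‖a‖ * ρ ^ n) ^ q * m ≤ ballIntegral d q φ (fun z => a * z i ^ n) r := by
  have hr0 : 0 < r := hρ.trans_lt hρr
  -- On this open set the monomial is at least `‖a‖ * ρ ^ n` and the density at least `1 / φ r`, so
  -- one constant serves all `a` and `n`.
  let U : Set (EuclideanSpace ℂ (Fin d)) := {z | ρ < ‖z i‖} ∩ Metric.ball 0 r
  have hU : IsOpen U :=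
    (isOpen_lt continuous_const (by fun_prop : Continuous fun z : EuclideanSpace ℂ (Fin d) =>
      ‖z i‖)).inter Metric.isOpen_ball
  have hUne : U.Nonempty := by
    obtain ⟨x, hx1, hx2⟩ := exists_between hρr
    have hx0 : 0 ≤ x := hρ.trans hx1.le
    refine ⟨EuclideanSpace.single i (x : ℂ), ?_, ?_⟩
    · simpa [abs_of_nonneg hx0] using hx1
    · simpa [abs_of_nonneg hx0] using hx2
  have hUfin : volume U ≠ ⊤ :=
    ne_top_of_le_ne_top measure_ball_lt_top.ne (measure_mono Set.inter_subset_right)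
  have hUpos : 0 < volume.real U := ENNReal.toReal_pos (hU.measure_pos _ hUne).ne' hUfin
  have hφr := hφ.pos r ⟨hr0.le, hr⟩
  refine ⟨1 / φ r * volume.real U, by positivity, fun a n => ?_⟩
  have hc : Continuous fun z : EuclideanSpace ℂ (Fin d) => a * z i ^ n := by fun_prop
  have hint := hφ.integrableOn_integrand hq hc.continuousOn hr
  calc (‖a‖ * ρ ^ n) ^ q * (1 / φ r * volume.real U)
      = ∫ z in U, (‖a‖ * ρ ^ n) ^ q * (1 / φ r) := by
        rw [setIntegral_const, smul_eq_mul]; ring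
    _ ≤ ∫ z in U, ‖a * z i ^ n‖ ^ q * (1 / φ ‖z‖) := by
        refine setIntegral_mono_on (integrableOn_const hUfin) (hint.mono_set Set.inter_subset_right)
          hU.measurableSet fun z hz => ?_
        have hzr : ‖z‖ < r := by simpa using hz.2
        have hzm : ‖z‖ ∈ Set.Ico (0 : ℝ) 1 := ⟨norm_nonneg z, hzr.trans hr⟩
        refine mul_le_mul (Real.rpow_le_rpow (by positivity) ?_ hq.le)
          (one_div_le_one_div_of_le (hφ.pos _ hzm) (hφ.monotoneOn hzm ⟨hr0.le, hr⟩ hzr.le))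
          (by positivity) (by positivity)
        rw [norm_mul, norm_pow]
        exact mul_le_mul_of_nonneg_left (pow_le_pow_left₀ hρ (le_of_lt hz.1) n) (norm_nonneg a)
    _ ≤ _ := by
        refine setIntegral_mono_set hint ?_ (LE.le.eventuallyLE Set.inter_subset_right)
        filter_upwards [ae_restrict_mem measurableSet_ball] with z hz
        exact mul_nonneg (Real.rpow_nonneg (norm_nonneg _) _) (hφ.one_div_norm_pos hr hz).le

end WeightedBall

/-! ### Convergence of the series -/

section Series

/-- A sparse power series in one coordinate whose terms are bounded on every smaller disc. -/
theorem exists_holomorphic_hasSum {d : ℕ} (i : Fin d) {a : ℕ → ℂ} {n : ℕ → ℕ}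
    (hn : StrictMono n) (h : ∀ ρ : ℝ, 0 < ρ → ρ < 1 → ∃ C : ℝ, ∀ j, ‖a j‖ * ρ ^ n j ≤ C) :
    ∃ f : EuclideanSpace ℂ (Fin d) → ℂ, DifferentiableOn ℂ f (unitBall d) ∧
      ∀ z ∈ unitBall d, HasSum (fun j => a j * z i ^ n j) (f z) := by
  have hsum : ∀ ρ : ℝ, 0 < ρ → ρ < 1 → Summable fun j => ‖a j‖ * ρ ^ n j := by
    intro ρ h0 h1
    -- Boundedness on the larger radius `σ` gives the majorant `C * (ρ / σ) ^ n j`, a subseries of a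
    -- geometric series.
    obtain ⟨σ, hρσ, hσ1⟩ := exists_between h1
    have hσ0 := h0.trans hρσ
    obtain ⟨C, hC⟩ := h σ hσ0 hσ1
    have hg : Summable fun k : ℕ => C * (ρ / σ) ^ k :=
      (summable_geometric_of_lt_one (by positivity) ((div_lt_one hσ0).2 hρσ)).mul_left C
    refine Summable.of_nonneg_of_le (fun j => by positivity) (fun j => ?_)
      (hg.comp_injective hn.injective)
    have : ‖a j‖ * ρ ^ n j = ‖a j‖ * σ ^ n j * (ρ / σ) ^ n j := by
      rw [div_pow]; field_simp
    rw [this]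
    exact mul_le_mul_of_nonneg_right (hC j) (by positivity)
  have hcoord : ∀ z : EuclideanSpace ℂ (Fin d), z ∈ unitBall d → z i ∈ Metric.ball (0 : ℂ) 1 := by
    intro z hz
    have h1 : ‖z‖ < 1 := by simpa [unitBall] using hz
    simpa using (PiLp.norm_apply_le z i).trans_lt h1
  have hdisc : ∀ x ∈ Metric.ball (0 : ℂ) 1, ∃ ρ : ℝ, 0 < ρ ∧ ρ < 1 ∧ ‖x‖ < ρ := by
    intro x hx
    obtain ⟨ρ, h1, h2⟩ := exists_between (by simpa using hx : ‖x‖ < 1)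
    exact ⟨ρ, (norm_nonneg x).trans_lt h1, h2, h1⟩
  have hbound : ∀ ρ : ℝ, ∀ j, ∀ x ∈ Metric.ball (0 : ℂ) ρ, ‖a j * x ^ n j‖ ≤ ‖a j‖ * ρ ^ n j := by
    intro ρ j x hx
    rw [norm_mul, norm_pow]
    exact mul_le_mul_of_nonneg_left
      (pow_le_pow_left₀ (norm_nonneg x) (by simpa using (Metric.mem_ball.1 hx).le) _) (norm_nonneg _)
  have hdiff : DifferentiableOn ℂ (fun x : ℂ => ∑' j, a j * x ^ n j) (Metric.ball 0 1) := by
    intro x hx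
    obtain ⟨ρ, h0, h1, hxρ⟩ := hdisc x hx
    have := Complex.differentiableOn_tsum_of_summable_norm (F := fun j (x : ℂ) => a j * x ^ n j)
      (hsum ρ h0 h1) (fun j => by fun_prop) Metric.isOpen_ball (hbound ρ)
    exact (this.differentiableAt (Metric.isOpen_ball.mem_nhds (by simpa using hxρ)))
      |>.differentiableWithinAt
  refine ⟨fun z => ∑' j, a j * z i ^ n j, ?_, fun z hz => ?_⟩
  · exact hdiff.comp (by fun_prop : Differentiable ℂ fun z : EuclideanSpace ℂ (Fin d) =>
      z i).differentiableOn hcoord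
  · obtain ⟨ρ, h0, h1, hxρ⟩ := hdisc _ (hcoord z hz)
    exact (Summable.of_norm_bounded (hsum ρ h0 h1)
      fun j => hbound ρ j _ (by simpa using hxρ)).hasSum

end Series

/-! ### Auxiliary facts for the comparison -/

theorem IsLogConvexWeight.rpow {w : ℝ → ℝ} (hw : IsLogConvexWeight w) {q : ℝ} (hq : 0 < q) :
    IsLogConvexWeight fun r => w r ^ q where
  pos r hr := Real.rpow_pos_of_pos (hw.pos r hr) q
  continuousOn := hw.continuousOn.rpow_const fun _ _ => Or.inr hq.le
  monotoneOn _ ha _ hb hab := Real.rpow_le_rpow (hw.pos _ ha).le (hw.monotoneOn ha hb hab) hq.le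
  logConvex := (hw.logConvex.smul hq.le).congr fun x hx => by
    simp only [smul_eq_mul]
    rw [Real.log_rpow (hw.pos _ ⟨(Real.exp_pos x).le, Real.exp_lt_one_iff.2 hx⟩)]

/-- The bound must survive `r → 1`, where `φ` may be unbounded; for `s ≤ 1 / 2` one has `φ (r s) ≤ φ
(1 / 2)`. -/
theorem IsWeight.exists_le_dilatedMoment {φ : ℝ → ℝ} (hφ : IsWeight φ) {p : ℝ} (hp : 0 ≤ p) :
    ∃ m : ℝ, 0 < m ∧ ∀ r ∈ Set.Ico (0 : ℝ) 1, m ≤ dilatedMoment φ p r := by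
  have hh : (1 / 2 : ℝ) ∈ Set.Ico (0 : ℝ) 1 := ⟨by norm_num, by norm_num⟩
  have hp1 : p + 1 ≠ 0 := by positivity
  have hφh := hφ.pos _ hh
  refine ⟨∫ s in (0 : ℝ)..(1 / 2), s ^ p / φ (1 / 2), ?_, fun r hr => ?_⟩
  · rw [intervalIntegral.integral_div, integral_rpow (Or.inl (by linarith)), Real.zero_rpow hp1]
    have : (0 : ℝ) < (1 / 2) ^ (p + 1) := Real.rpow_pos_of_pos (by norm_num) _
    rw [sub_zero]
    positivity
  · have hint := hφ.intervalIntegrable_dilated hp hr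
    calc _ ≤ ∫ s in (0 : ℝ)..(1 / 2), s ^ p / φ (r * s) := by
          refine intervalIntegral.integral_mono_on (by norm_num)
            (((Real.continuous_rpow_const hp).div_const _).intervalIntegrable _ _)
            (hint.mono_set ?_) fun s hs => ?_
          · rw [Set.uIcc_of_le (by norm_num), Set.uIcc_of_le (by norm_num)]
            exact Set.Icc_subset_Icc le_rfl (by norm_num)
          · have hrs := IsWeight.mul_mem_Ico hr (s := s) ⟨hs.1, by linarith [hs.2]⟩
            exact div_le_div_of_nonneg_left (Real.rpow_nonneg hs.1 _) (hφ.pos _ hrs)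
              (hφ.monotoneOn hrs hh (by nlinarith [hs.1, hs.2, hr.1, hr.2]))
      _ ≤ _ := by
          refine intervalIntegral.integral_mono_interval le_rfl (by norm_num) (by norm_num) ?_ hint
          filter_upwards [ae_restrict_mem measurableSet_Ioc] with s hs
          exact div_nonneg (Real.rpow_nonneg hs.1.le _)
            (hφ.pos _ (IsWeight.mul_mem_Ico hr ⟨hs.1.le, hs.2⟩)).le

theorem le_rpow_mul_of_rpow_le {x y C t : ℝ} (hx : 0 ≤ x) (hy : 0 ≤ y) (hC : 0 ≤ C) (ht : 0 < t)
    (h : x ^ t ≤ C * y ^ t) : x ≤ C ^ (1 / t) * y := by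
  have h1 := Real.rpow_le_rpow (Real.rpow_nonneg hx t) h (one_div_pos.2 ht).le
  rwa [Real.mul_rpow hC (Real.rpow_nonneg hy t), ← Real.rpow_mul hx, ← Real.rpow_mul hy,
    mul_one_div_cancel ht.ne', Real.rpow_one, Real.rpow_one] at h1

/-- The mean at `0` is given by a separate formula; being positive, it only enlarges the constants.
-/
theorem equivalentOn_Ico_of_Ioo {u v : ℝ → ℝ} {C D : ℝ} (hC : 0 < C) (hD : 0 < D)
    (hu0 : 0 < u 0) (hv : ∀ r ∈ Set.Ico (0 : ℝ) 1, 0 < v r)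
    (h : ∀ r ∈ Set.Ioo (0 : ℝ) 1, u r ≤ C * v r ∧ v r ≤ D * u r) :
    EquivalentOn (Set.Ico 0 1) u v := by
  have hv0 := hv 0 ⟨le_rfl, one_pos⟩
  have key : ∀ r ∈ Set.Ico (0 : ℝ) 1, u r ≤ max C (u 0 / v 0) * v r ∧
      v r ≤ max D (v 0 / u 0) * u r ∧ 0 < u r := by
    intro r hr
    rcases hr.1.eq_or_lt with h0 | h0
    · rw [← h0]
      refine ⟨?_, ?_, hu0⟩
      · rw [← div_le_iff₀ hv0]; exact le_max_right _ _
      · rw [← div_le_iff₀ hu0]; exact le_max_right _ _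
    · obtain ⟨h1, h2⟩ := h r ⟨h0, hr.2⟩
      have hur : 0 < u r := pos_of_mul_pos_right ((hv r hr).trans_le h2) hD.le
      exact ⟨h1.trans (mul_le_mul_of_nonneg_right (le_max_left _ _) (hv r hr).le),
        h2.trans (mul_le_mul_of_nonneg_right (le_max_left _ _) hur.le), hur⟩
  have hCm : 0 < max C (u 0 / v 0) := hC.trans_le (le_max_left _ _)
  refine ⟨fun r hr => ⟨(key r hr).2.2, hv r hr⟩, (max C (u 0 / v 0))⁻¹, max D (v 0 / u 0),
    inv_pos.2 hCm, hD.trans_le (le_max_left _ _), fun r hr => ⟨?_, (key r hr).2.1⟩⟩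
  rw [inv_mul_le_iff₀ hCm]
  exact (key r hr).1

/-! ### Construction of the function and the two-sided estimate -/

section Main

variable {φ w : ℝ → ℝ} {d : ℕ} {q : ℝ}

/-- For a bounded weight, the constant function `1` has the required growth. -/
theorem volumeMean_one_equivalentOn (hd : 1 ≤ d) (hq : 0 < q) (hφ : IsWeight φ) (hw : IsWeight w)
    {B : ℝ} (hB : ∀ r ∈ Set.Ico (0 : ℝ) 1, w r ≤ B) :
    EquivalentOn (Set.Ico 0 1) (volumeMean d q (fun t => 1 / φ t) fun _ => 1) w := by
  let i : Fin d := ⟨0, hd⟩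
  have m0 : (0 : ℝ) ∈ Set.Ico (0 : ℝ) 1 := ⟨le_rfl, one_pos⟩
  have hp := monomialMean_exponent_nonneg hd hq 0
  obtain ⟨m, hm0, hm⟩ := hφ.exists_le_dilatedMoment hp
  obtain ⟨M, hM⟩ : ∃ M, M = 1 / (((0 : ℕ) * q + (2 * d - 1) + 1) * φ 0) := ⟨_, rfl⟩
  have hφ0 := hφ.pos 0 m0
  have hM0 : 0 < M := by rw [hM]; positivity
  have hV := volume_unitBall_toReal_pos d
  obtain ⟨K, hK⟩ : ∃ K, K = (volume (unitBall d)).toReal⁻¹ * sphereMoment i ((0 : ℕ) * q) :=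
    ⟨_, rfl⟩
  have hK0 : 0 < K := by
    rw [hK]; exact mul_pos (inv_pos.2 hV) (sphereMoment_pos i (by simp))
  have hmean : ∀ r ∈ Set.Ioo (0 : ℝ) 1, volumeMean d q (fun t => 1 / φ t) (fun _ => 1) r
      = (K * dilatedMoment φ ((0 : ℕ) * q + (2 * d - 1)) r) ^ (1 / q) := by
    intro r hr
    have h := ballIntegral_monomial (d := d) (q := q) i 1 0 hr.1 φ
    simp only [pow_zero, mul_one, norm_one, Real.one_rpow, one_mul, monomialMean,
      Nat.cast_zero, zero_mul, Real.rpow_zero] at h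
    rw [volumeMean_eq φ q _ hr, h, hK]
    congr 1
    have : r ^ (2 * d) ≠ 0 := pow_ne_zero _ hr.1.ne'
    simp only [Nat.cast_zero, zero_mul]
    field_simp
  have hB0 : 0 < B := (hw.pos 0 m0).trans_le (hB 0 m0)
  have hw0 := hw.pos 0 m0
  have hKm : 0 < (K * m) ^ (1 / q) := Real.rpow_pos_of_pos (by positivity) _
  have hKM : 0 < (K * M) ^ (1 / q) := Real.rpow_pos_of_pos (by positivity) _
  refine equivalentOn_Ico_of_Ioo (C := (K * M) ^ (1 / q) / w 0) (D := B / (K * m) ^ (1 / q))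
    (by positivity) (by positivity) ?_ hw.pos fun r hr => ?_
  · simp only [volumeMean, if_true, norm_one, one_mul]
    exact Real.rpow_pos_of_pos (by positivity) _
  have hr' : r ∈ Set.Ico (0 : ℝ) 1 := ⟨hr.1.le, hr.2⟩
  rw [hmean r hr]
  have hJ := hφ.dilatedMoment_pos hp hr'
  constructor
  · calc _ ≤ (K * M) ^ (1 / q) := by
          refine Real.rpow_le_rpow (by positivity) ?_ (by positivity)
          rw [hM]
          exact mul_le_mul_of_nonneg_left (hφ.dilatedMoment_le hp hr') hK0.le
      _ = (K * M) ^ (1 / q) / w 0 * w 0 := by field_simp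
      _ ≤ _ := mul_le_mul_of_nonneg_left (hw.monotoneOn m0 hr' hr.1.le) (by positivity)
  · calc w r ≤ B := hB r hr'
      _ = B / (K * m) ^ (1 / q) * (K * m) ^ (1 / q) := by field_simp
      _ ≤ _ := by
          refine mul_le_mul_of_nonneg_left (Real.rpow_le_rpow (by positivity) ?_ (by positivity))
            (by positivity)
          exact mul_le_mul_of_nonneg_left (hm r hr') hK0.le

/-- For an unbounded log-convex weight, a sparse power series in one coordinate has the
required growth. -/
theorem exists_volumeMean_equivalentOn (hd : 1 ≤ d) (hq : 0 < q) (hφ : IsLogConvexWeight φ)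
    (hw : IsLogConvexWeight w) (hunb : ∀ B : ℝ, ∃ b ∈ Set.Ico (0 : ℝ) 1, B ≤ w b ^ q) :
    ∃ f : EuclideanSpace ℂ (Fin d) → ℂ, DifferentiableOn ℂ f (unitBall d) ∧
      EquivalentOn (Set.Ico 0 1) (volumeMean d q (fun t => 1 / φ t) f) w := by
  let i : Fin d := ⟨0, hd⟩
  have hφw := hφ.toIsWeight
  have m0 : (0 : ℝ) ∈ Set.Ico (0 : ℝ) 1 := ⟨le_rfl, one_pos⟩
  have hWpos : ∀ r ∈ Set.Ico (0 : ℝ) 1, 0 < w r ^ q := (hw.rpow hq).pos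
  obtain ⟨c, y, hc, hpk⟩ := exists_isPeakedSequence hφ (hw.rpow hq) hd hq hunb
  obtain ⟨s, hs⟩ : ∃ s, s = min 1 (1 / q) := ⟨_, rfl⟩
  have hs0 : 0 < s := hs ▸ min_one_one_div_pos hq
  -- The gauge takes the power `s` of the integrals; this ratio becomes the `1 / 16` of the
  -- domination lemma.
  have hη : (0 : ℝ) < (1 / 16) ^ (1 / s) := Real.rpow_pos_of_pos (by norm_num) _
  have hηs : ((1 / 16 : ℝ) ^ (1 / s)) ^ s = 1 / 16 := by
    rw [← Real.rpow_mul (by norm_num), one_div_mul_cancel hs0.ne', Real.rpow_one]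
  obtain ⟨n, hn, hn0, δ, hδ, H⟩ := hpk.exists_sparse hq hη
  have hV := volume_unitBall_toReal_pos d
  obtain ⟨V, hVeq⟩ : ∃ V, V = (volume (unitBall d)).toReal := ⟨_, rfl⟩
  rw [← hVeq] at hV
  obtain ⟨T, hT⟩ : ∃ T : ℕ → ℝ → ℝ, ∀ j r, T j r = c (n j) * monomialMean φ d q (n j) r :=
    ⟨_, fun _ _ => rfl⟩
  have hτ : ∀ j r, c (n j) * (monomialMean φ d q (n j) r / w r ^ q) = T j r / w r ^ q :=
    fun j r => by rw [hT, mul_div_assoc]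
  have hT0 : ∀ j, ∀ r ∈ Set.Ico (0 : ℝ) 1, 0 ≤ T j r := fun j r hr => by
    rw [hT]; exact mul_nonneg (hc _).le (hφw.monomialMean_nonneg hd hq hr)
  have hTW : ∀ j, ∀ r ∈ Set.Ico (0 : ℝ) 1, T j r ≤ w r ^ q := fun j r hr => by
    have := hpk.le_one (n j) r hr
    simp only [hτ] at this
    exact (div_le_one (hWpos r hr)).1 this
  have hS : ∀ j, 0 < sphereMoment i (n j * q) := fun j => sphereMoment_pos i (by positivity)
  -- The coefficients make the normalized integral of the `j`-th term exactly `T j`, whose quotient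
  -- by `w ^ q` has maximum `1`.
  obtain ⟨α, hα⟩ : ∃ α : ℕ → ℝ, ∀ j, α j = (c (n j) * V / sphereMoment i (n j * q)) ^ (1 / q) :=
    ⟨_, fun _ => rfl⟩
  have hαbase : ∀ j, 0 < c (n j) * V / sphereMoment i (n j * q) := fun j =>
    div_pos (mul_pos (hc _) hV) (hS j)
  have hα0 : ∀ j, 0 < α j := fun j => by
    rw [hα]; exact Real.rpow_pos_of_pos (hαbase j) _
  have hαq : ∀ j, α j ^ q = c (n j) * V / sphereMoment i (n j * q) := fun j => by
    rw [hα, ← Real.rpow_mul (hαbase j).le, one_div_mul_cancel hq.ne', Real.rpow_one]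
  have hnormα : ∀ j, ‖(α j : ℂ)‖ = α j := fun j => by
    rw [Complex.norm_real, Real.norm_of_nonneg (hα0 j).le]
  have hI : ∀ j, ∀ r ∈ Set.Ioo (0 : ℝ) 1,
      ballIntegral d q φ (fun z => (α j : ℂ) * z i ^ n j) r = V * r ^ (2 * d) * T j r := by
    intro j r hr
    rw [ballIntegral_monomial i _ _ hr.1, hnormα, hαq, hT]
    have := (hS j).ne'
    field_simp
  -- Since `T j ≤ w ^ q`, the integrals of the terms over a ball of radius `r > ρ` are uniformly
  -- bounded, which bounds `α j * ρ ^ n j`.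
  obtain ⟨f, hf, hsum⟩ := exists_holomorphic_hasSum i (a := fun j => (α j : ℂ)) hn (by
    intro ρ h0 h1
    obtain ⟨r, hρr, hr1⟩ := exists_between h1
    have hr : r ∈ Set.Ioo (0 : ℝ) 1 := ⟨h0.trans hρr, hr1⟩
    obtain ⟨m, hm, hle⟩ := hφw.exists_le_ballIntegral_monomial (d := d) hq i h0.le hρr hr1
    refine ⟨(V * r ^ (2 * d) * w r ^ q / m) ^ (1 / q), fun j => ?_⟩
    have h2 := hle (α j) (n j)
    rw [hI j r hr] at h2
    have h3 : V * r ^ (2 * d) * T j r ≤ V * r ^ (2 * d) * w r ^ q :=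
      mul_le_mul_of_nonneg_left (hTW j r ⟨hr.1.le, hr.2⟩)
        (mul_nonneg hV.le (pow_nonneg hr.1.le _))
    have h4 := (le_div_iff₀ hm).2 (h2.trans h3)
    have h5 := Real.rpow_le_rpow (Real.rpow_nonneg (by positivity) _) h4
      (one_div_pos.2 hq).le
    rwa [← Real.rpow_mul (by positivity), mul_one_div_cancel hq.ne', Real.rpow_one] at h5)
  have hfc : ContinuousOn f (unitBall d) := hf.continuousOn
  refine ⟨f, hf, ?_⟩
  have hqs : 0 < q * s := mul_pos hq hs0
  have hδs : 0 < δ ^ s := Real.rpow_pos_of_pos hδ _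
  refine equivalentOn_Ico_of_Ioo (C := 4 ^ (1 / (q * s))) (D := (6 / δ ^ s) ^ (1 / (q * s)))
    (Real.rpow_pos_of_pos (by norm_num) _) (Real.rpow_pos_of_pos (by positivity) _) ?_ hw.pos
    fun r hr => ?_
  · have hf0 : f 0 = α 0 := by
      have h0 : (0 : EuclideanSpace ℂ (Fin d)) ∈ unitBall d := by simp [unitBall]
      refine (hsum 0 h0).unique ?_
      -- As `n 0 = 0`, the series has a non-zero constant term, so the mean is positive at `0`.
      have h1 : ∀ j, j ≠ 0 → (α j : ℂ) * (0 : EuclideanSpace ℂ (Fin d)) i ^ n j = 0 := by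
        intro j hj
        have : n j ≠ 0 := by
          rw [← hn0]; exact hn.injective.ne hj
        simp [this]
      have h2 := hasSum_single (f := fun j => (α j : ℂ) * (0 : EuclideanSpace ℂ (Fin d)) i ^ n j) 0 h1
      simpa [hn0] using h2
    simp only [volumeMean, if_true, hf0, hnormα]
    have := hφ.pos 0 m0
    exact mul_pos (hα0 0) (Real.rpow_pos_of_pos (by positivity) _)
  have hr' : r ∈ Set.Ico (0 : ℝ) 1 := ⟨hr.1.le, hr.2⟩
  obtain ⟨k, hk, hk1, hk2⟩ := H r hr'
  simp only [hτ] at hk hk1 hk2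
  have hW := hWpos r hr'
  obtain ⟨D, hD⟩ : ∃ D, D = V * r ^ (2 * d) := ⟨_, rfl⟩
  have hD0 : 0 < D := by rw [hD]; exact mul_pos hV (pow_pos hr.1 _)
  have hDs : 0 < D ^ s := Real.rpow_pos_of_pos hD0 _
  have hTs : ∀ j, 0 ≤ T j r ^ s := fun j => Real.rpow_nonneg (hT0 j r hr') _
  have hstep : ∀ j l, T j r / w r ^ q ≤ (1 / 16) ^ (1 / s) * (T l r / w r ^ q) →
      D ^ s * T j r ^ s ≤ 1 / 16 * (D ^ s * T l r ^ s) := by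
    intro j l h
    rw [← mul_div_assoc, div_le_div_iff_of_pos_right hW] at h
    have := Real.rpow_le_rpow (hT0 j r hr') h hs0.le
    rw [Real.mul_rpow hη.le (hT0 l r hr'), hηs] at this
    nlinarith
  have hmono : ∀ j, Continuous fun z : EuclideanSpace ℂ (Fin d) => (α j : ℂ) * z i ^ n j :=
    fun j => by fun_prop
  have hdom := lpGauge_dominated_sum (μ := weightedBall φ d r)
    (A := fun j z => (α j : ℂ) * z i ^ n j) (F := f) (u := fun j => D ^ s * T j r ^ s) (k := k) hq
    (fun j => aemeasurable_weightedBall (hmono j).continuousOn hr.2)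
    (aemeasurable_weightedBall hfc hr.2)
    (by
      have : ∀ᵐ z ∂(volume.restrict (Metric.ball (0 : EuclideanSpace ℂ (Fin d)) r)),
          HasSum (fun j => (α j : ℂ) * z i ^ n j) (f z) := by
        filter_upwards [ae_restrict_mem measurableSet_ball] with z hz
        exact hsum z (Metric.ball_subset_ball hr.2.le hz)
      exact (withDensity_absolutelyContinuous _ _).ae_le this)
    (fun j => mul_nonneg hDs.le (hTs j))
    (fun j => by
      rw [hφw.lpGauge_weightedBall hq hr.2 (hmono j).continuousOn, hI j r hr, ← hD, ← hs,
        Real.mul_rpow hD0.le (hT0 j r hr')])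
    (fun j hj => hstep _ _ (hk1 j hj)) (fun j hj => hstep _ _ (hk2 j hj))
    (hφw.lpGauge_monomial_sub hr.2 i _ _ (hn (Nat.lt_succ_self k)))
  rw [hφw.lpGauge_weightedBall hq hr.2 hfc, ← hs] at hdom
  obtain ⟨hup, hlow⟩ := hdom
  obtain ⟨X, hX⟩ : ∃ X, X = 1 / r ^ (2 * d) * (V⁻¹ * ballIntegral d q φ f r) := ⟨_, rfl⟩
  have hrd : 0 < r ^ (2 * d) := pow_pos hr.1 _
  have hIf := hφw.ballIntegral_nonneg (q := q) hr.2 f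
  have hX0 : 0 ≤ X := by rw [hX]; positivity
  have hIX : ballIntegral d q φ f r = D * X := by rw [hX, hD]; field_simp
  rw [hIX, Real.mul_rpow hD0.le hX0] at hup hlow
  have hXs : 0 ≤ X ^ s := Real.rpow_nonneg hX0 _
  have hTk := hTs k
  have hTk1 := hTs (k + 1)
  rw [ENNReal.ofReal_le_ofReal_iff (by positivity)] at hup
  rw [show (6 : ENNReal) = ENNReal.ofReal 6 by norm_num, ← ENNReal.ofReal_mul (by norm_num),
    ENNReal.ofReal_le_ofReal_iff (by positivity)] at hlow
  have hup' : X ^ s ≤ 2 * (T k r ^ s + T (k + 1) r ^ s) :=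
    le_of_mul_le_mul_left (hup.trans_eq (by ring)) hDs
  have hlow' : T k r ^ s + T (k + 1) r ^ s ≤ 6 * X ^ s :=
    le_of_mul_le_mul_left ((le_of_eq (by ring)).trans (hlow.trans_eq (by ring))) hDs
  have hTWs : ∀ j, T j r ^ s ≤ (w r ^ q) ^ s := fun j =>
    Real.rpow_le_rpow (hT0 j r hr') (hTW j r hr') hs0.le
  have hTlow : δ ^ s * (w r ^ q) ^ s ≤ T k r ^ s + T (k + 1) r ^ s := by
    rw [← Real.mul_rpow hδ.le hW.le]
    rcases hk with hk | hk
    · rw [le_div_iff₀ hW] at hk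
      linarith [Real.rpow_le_rpow (by positivity) hk hs0.le]
    · rw [le_div_iff₀ hW] at hk
      linarith [Real.rpow_le_rpow (by positivity) hk hs0.le]
  have hwr := hw.pos r hr'
  -- The gauge estimates compare powers `s` of `X` and `w ^ q`, that is, powers `q * s` of the mean
  -- and of `w`; extracting the root gives the constants `4 ^ (1 / (q * s))` and `(6 / δ ^ s) ^ (1 /
  -- (q * s))`.
  have hmeanX : (X ^ (1 / q)) ^ (q * s) = X ^ s := by
    rw [← Real.rpow_mul hX0]; congr 1; field_simp
  have hwX : w r ^ (q * s) = (w r ^ q) ^ s := Real.rpow_mul hwr.le q s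
  rw [volumeMean_eq φ q f hr, ← hVeq, ← hX]
  have hXq : 0 ≤ X ^ (1 / q) := Real.rpow_nonneg hX0 _
  constructor
  · refine le_rpow_mul_of_rpow_le hXq hwr.le (by norm_num) hqs ?_
    rw [hmeanX, hwX]
    linarith [hTWs k, hTWs (k + 1)]
  · refine le_rpow_mul_of_rpow_le hwr.le hXq (by positivity) hqs ?_
    rw [hmeanX, hwX, div_mul_eq_mul_div, le_div_iff₀ hδs]
    linarith

end Main

theorem proposition3p1 (d : ℕ) (hd : 1 ≤ d) (q : ℝ) (hq : 0 < q)
    (φ w : ℝ → ℝ) (hφ : IsLogConvexWeight φ) (hw : IsLogConvexWeight w) :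
    ∃ f : EuclideanSpace ℂ (Fin d) → ℂ,
      DifferentiableOn ℂ f (unitBall d) ∧
      EquivalentOn (Set.Ico 0 1) (volumeMean d q (fun t => 1 / φ t) f) w := by
  by_cases hunb : ∀ B : ℝ, ∃ b ∈ Set.Ico (0 : ℝ) 1, B ≤ w b ^ q
  · exact exists_volumeMean_equivalentOn hd hq hφ hw hunb
  · push Not at hunb
    obtain ⟨B, hB⟩ := hunb
    refine ⟨fun _ => 1, differentiableOn_const 1,
      volumeMean_one_equivalentOn hd hq hφ.toIsWeight hw.toIsWeight (B := B ^ (1 / q))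
        fun r hr => ?_⟩
    have h := Real.rpow_le_rpow (Real.rpow_nonneg (hw.pos r hr).le q) (hB r hr).le
      (one_div_pos.2 hq).le
    rwa [← Real.rpow_mul (hw.pos r hr).le, mul_one_div_cancel hq.ne', Real.rpow_one] at h
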